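/- \textbf{Theorem (approximate span-liftings for DP, RDP, zCDP, tCDP).} Let $\mathcal G$ be the sub-Giry monad on the category $\mathbf{Meas}$ of measurable spaces: $\mathcal GX$ is the space of subprobability measures on $X$, the unit is the Dirac measure $x\mapsto\mathbf d_x$, the Kleisli extension is $f^\sharp(\mu)(S)=\int f(x)(S)\,d\mu(x)$, and the double strength is $\mathrm{dst}(\mu,\nu)=\mu\otimes\nu$. Let $\mathbf{Span}(\mathbf{Meas})$ be the category whose objects are spans $X\xleftarrow{\rho_1}\Phi\xrightarrow{\rho_2}Y$ in $\mathbf{Meas}$ and whose morphisms are triples $(h,k,l)$ with $h\rho_1=\rho_1'l$ and $k\rho_2=\rho_2'l$, with componentwise binary products $\dot\times$, and let $U(X,Y,\Phi,\rho_1,\rho_2)=(X,Y)$ be the forgetful functor to $\mathbf{Meas}\times\mathbf{Meas}$. For $\mu_1,\mu_2\in\mathcal GX$ with densities $p_1,p_2$ with respect to $\lambda=\mu_1+\mu_2$, and a weight function $f:\mathbb R_{\ge0}\to\mathbb R_{\ge0}$, put $\Delta^f_X(\mu_1,\mu_2)=\int p_2f(p_1/p_2)\,d\lambda\in[0,\infty]$,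 with the conventions $0f(0/0)=0$ and $0f(a/0)=\lim_{t\to0+}tf(a/t)$ for $a>0$. Define \begin{itemize} \item $\Delta^{\mathtt{DP}(\varepsilon)}=\Delta^f$ with $f(t)=\max(0,1-e^\varepsilon t)$, for $\varepsilon\ge0$; \item $D^\alpha_X(\mu_1\|\mu_2)=\frac1{\alpha-1}\log\Delta^{g}_X(\mu_1,\mu_2)$ with $g(t)=t^\alpha$, for $\alpha>1$ (with $\log0=-\infty$, $\log\infty=\infty$); \item $\Delta^{\mathtt{zCDP}(\xi)}=\sup_{1<\alpha}\frac1\alpha(D^\alpha-\xi)$, for $\xi\ge0$; \item $\Delta^{\omega\text{-}\mathtt{tCDP}}=\sup_{1<\alpha<\omega}\frac1\alpha D^\alpha$, for $\omega>1$. \end{itemize} For such a divergence $\Delta$ and $\delta\in\overline{\mathbb R}=[-\infty,\infty]$ let $$(X,Y,\Phi,\rho_1,\rho_2)^{\sharp(\Delta,\delta)}=(\mathcal GX,\ \mathcal GY,\ W(\Phi,\Delta,\delta),\ \mathcal G\rho_1\circ\pi_1,\ \mathcal G\rho_2\circ\pi_2),$$ where $W(\Phi,\Delta,\delta)=\{(\nu_1,\nu_2)\in\mathcal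 G\Phi\times\mathcal G\Phi\mid\Delta_\Phi(\nu_1,\nu_2)\le\delta\}$ carries the subspace $\sigma$-algebra. Regard $\mathbb R_{\ge0}$ and $\overline{\mathbb R}$ as ordered additive monoids, with $\infty+(-\infty)=-\infty$, and products of them with the componentwise structure. Then each of the following families is an $A$-graded monad on $\mathbf{Span}(\mathbf{Meas})$ which is a graded lifting of the monad $\mathcal G\times\mathcal G$ along $U$, with a (symmetric) double strength lying over that of $\mathcal G\times\mathcal G$: \begin{enumerate} \item (DP) $\{(-)^{\sharp(\Delta^{\mathtt{DP}(\varepsilon)},\delta)}\}_{(\varepsilon,\delta)}$ with $A=\mathbb R_{\ge0}\times\mathbb R_{\ge0}$; \item (RDP) $\{(-)^{\sharp(D^\alpha,\rho)}\}_{\rho}$ with $A=\overline{\mathbb R}$, for every $\alpha>1$; \item (zCDP) $\{(-)^{\sharp(\Delta^{\mathtt{zCDP}(\xi)},\rho)}\}_{(\xi,\rho)}$ with $A=\mathbb R_{\ge0}\times\overline{\mathbb R}$; \item (tCDP) $\{(-)^{\sharp(\Delta^{\omega\text{-}\mathtt{tCDP}},\rho)}\}_{\rho}$ with $A=\overline{\mathbb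 R}$, for every $\omega>1$. \end{enumerate} Writing $\Phi^{\sharp a}$ for the member of the family at grade $a\in A$, the structure maps are: the functor action $(h,k,l)\mapsto(\mathcal Gh,\mathcal Gk,\mathcal Gl\times\mathcal Gl)$; the unit $(\eta_X,\eta_Y,\langle\eta_\Phi,\eta_\Phi\rangle):\Phi\to\Phi^{\sharp 0}$; the Kleisli lifting of $(h,k,l):\Phi\to\Psi^{\sharp b}$, namely $(h^\sharp,k^\sharp,(\pi_1l)^\sharp\times(\pi_2l)^\sharp):\Phi^{\sharp a}\to\Psi^{\sharp(a+b)}$; the inclusions $(\mathrm{id},\mathrm{id},\mathrm{id}\times\mathrm{id}):\Phi^{\sharp a}\to\Phi^{\sharp b}$ for $a\le b$; and the double strength $(\mathrm{dst},\mathrm{dst},\langle\mathrm{dst}\circ(\pi_1\times\pi_1),\mathrm{dst}\circ(\pi_2\times\pi_2)\rangle):\Phi^{\sharp a}\mathbin{\dot\times}\Psi^{\sharp b}\to(\Phi\mathbin{\dot\times}\Psi)^{\sharp(a+b)}$. Here all third components are restricted to the witness spaces $W$. -/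

import Mathlib

open CategoryTheory CategoryTheory.Limits MonoidalCategory MeasureTheory
open scoped NNReal ENNReal Topology

universe u v w

noncomputable section

namespace SpanLifting

/-! ### Graded monads, graded liftings and double strengths -/

section GradedMonads

/-- The Kleisli extension `f^♯ : M X ⟶ M Y` of `f : X ⟶ M Y` for a monad `M`. -/
def kleisliExt {C : Type u} [Category.{v} C] (M : CategoryTheory.Monad C) {X Y : C}
    (f : X ⟶ M.obj Y) : M.obj X ⟶ M.obj Y :=
  M.map f ≫ M.μ.app Y

/-- The identity `T a X = T b X` for equal grades `a = b`. -/
def gradeCast {A : Type w} {C : Type u} [Category.{v} C] (T : A → C → C) {a b : A}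
    (h : a = b) (X : C) : T a X ⟶ T b X :=
  eqToHom (by rw [h])

/-- An `A`-graded monad on `C` with action `T` on objects, for a preordered (additively written)
monoid `A`: functors `T a`, a unit, graded Kleisli liftings and inclusions. -/
structure GradedMonad (A : Type w) [AddMonoid A] [Preorder A] [AddLeftMono A] [AddRightMono A]
    (C : Type u) [Category.{v} C] (T : A → C → C) where
  map : ∀ (a : A) {X Y : C}, (X ⟶ Y) → (T a X ⟶ T a Y)
  unit : ∀ X : C, X ⟶ T 0 X
  klift : ∀ (a : A) {b : A} {X Y : C}, (X ⟶ T b Y) → (T a X ⟶ T (a + b) Y)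
  incl : ∀ {a b : A}, a ≤ b → ∀ X : C, T a X ⟶ T b X
  map_id : ∀ (a : A) (X : C), map a (𝟙 X) = 𝟙 (T a X)
  map_comp : ∀ (a : A) {X Y Z : C} (f : X ⟶ Y) (g : Y ⟶ Z),
    map a (f ≫ g) = map a f ≫ map a g
  incl_naturality : ∀ {a b : A} (h : a ≤ b) {X Y : C} (f : X ⟶ Y),
    map a f ≫ incl h Y = incl h X ≫ map b f
  incl_refl : ∀ (a : A) (X : C), incl (le_refl a) X = 𝟙 (T a X)
  incl_trans : ∀ {a b c : A} (h : a ≤ b) (h' : b ≤ c) (X : C),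
    incl h X ≫ incl h' X = incl (h.trans h') X
  klift_incl : ∀ (a : A) {b c : A} (h : b ≤ c) {X Y : C} (f : X ⟶ T b Y),
    klift a f ≫ incl (add_le_add le_rfl h) Y = klift a (f ≫ incl h Y)
  incl_klift : ∀ {a b c : A} (h : a ≤ b) {X Y : C} (f : X ⟶ T c Y),
    incl h X ≫ klift b f = klift a f ≫ incl (add_le_add h le_rfl) Y
  unit_klift : ∀ {a : A} {X Y : C} (f : X ⟶ T a Y),
    unit X ≫ klift 0 f = f ≫ gradeCast T (zero_add a).symm Y
  klift_unit : ∀ (a : A) (X : C), klift a (unit X) = gradeCast T (add_zero a).symm X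
  klift_klift : ∀ (a : A) {b c : A} {X Y Z : C} (f : X ⟶ T b Y) (g : Y ⟶ T c Z),
    klift a (f ≫ klift b g) = klift a f ≫ klift (a + b) g ≫ gradeCast T (add_assoc a b c) Z
  klift_comp_unit : ∀ (a : A) {X Y : C} (f : X ⟶ Y),
    klift a (f ≫ unit Y) = map a f ≫ gradeCast T (add_zero a).symm Y

/-- A graded monad `L` on `C` is a graded lifting of the monad `M` on `D` along `U : C ⥤ D`:
`U` strictly maps the functors, the unit and the Kleisli liftings of `L` to those of `M`, and the
inclusions of `L` to identities. -/
structure IsGradedLifting {A : Type w} [AddMonoid A] [Preorder A] [AddLeftMono A]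
    [AddRightMono A] {C : Type u} [Category.{v} C] {D : Type u} [Category.{v} D]
    {T : A → C → C} (L : GradedMonad A C T) (U : C ⥤ D) (M : CategoryTheory.Monad D) : Prop where
  obj_eq : ∀ (a : A) (X : C), U.obj (T a X) = M.obj (U.obj X)
  map_eq : ∀ (a : A) {X Y : C} (f : X ⟶ Y),
    U.map (L.map a f) = eqToHom (obj_eq a X) ≫ M.map (U.map f) ≫ eqToHom (obj_eq a Y).symm
  unit_eq : ∀ X : C, U.map (L.unit X) = M.η.app (U.obj X) ≫ eqToHom (obj_eq 0 X).symm
  klift_eq : ∀ (a : A) {b : A} {X Y : C} (f : X ⟶ T b Y),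
    U.map (L.klift a f) = eqToHom (obj_eq a X) ≫
      kleisliExt M (U.map f ≫ eqToHom (obj_eq b Y)) ≫ eqToHom (obj_eq (a + b) Y).symm
  incl_eq : ∀ {a b : A} (h : a ≤ b) (X : C),
    U.map (L.incl h X) = eqToHom ((obj_eq a X).trans (obj_eq b X).symm)

/-- A (symmetric) double strength of a graded monad on a symmetric monoidal category: a graded
family `T a X ⊗ T b Y ⟶ T (a + b) (X ⊗ Y)`, natural in `X`, `Y` and the grades, compatible with
the unit, the Kleisli liftings and the coherence isomorphisms. -/
structure DoubleStrength {A : Type w} [AddCommMonoid A] [Preorder A] [AddLeftMono A]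
    [AddRightMono A] {C : Type u} [Category.{v} C] [MonoidalCategory C] [SymmetricCategory C]
    {T : A → C → C} (L : GradedMonad A C T) where
  dst : ∀ (a b : A) (X Y : C), T a X ⊗ T b Y ⟶ T (a + b) (X ⊗ Y)
  naturality : ∀ (a b : A) {X X' Y Y' : C} (f : X ⟶ X') (g : Y ⟶ Y'),
    (L.map a f ⊗ₘ L.map b g) ≫ dst a b X' Y' = dst a b X Y ≫ L.map (a + b) (f ⊗ₘ g)
  incl : ∀ {a a' b b' : A} (h : a ≤ a') (h' : b ≤ b') (X Y : C),
    (L.incl h X ⊗ₘ L.incl h' Y) ≫ dst a' b' X Y =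
      dst a b X Y ≫ L.incl (add_le_add h h') (X ⊗ Y)
  unit : ∀ X Y : C,
    (L.unit X ⊗ₘ L.unit Y) ≫ dst 0 0 X Y =
      L.unit (X ⊗ Y) ≫ gradeCast T (add_zero (0 : A)).symm (X ⊗ Y)
  klift : ∀ (c d : A) {a b : A} {X X' Y Y' : C} (f : X ⟶ T a X') (g : Y ⟶ T b Y'),
    (L.klift c f ⊗ₘ L.klift d g) ≫ dst (c + a) (d + b) X' Y' =
      dst c d X Y ≫ L.klift (c + d) ((f ⊗ₘ g) ≫ dst a b X' Y') ≫
        gradeCast T (add_add_add_comm c d a b) (X' ⊗ Y')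
  associativity : ∀ (a b c : A) (X Y Z : C),
    (dst a b X Y ⊗ₘ 𝟙 (T c Z)) ≫ dst (a + b) c (X ⊗ Y) Z ≫ L.map (a + b + c) (α_ X Y Z).hom ≫
        gradeCast T (add_assoc a b c) (X ⊗ (Y ⊗ Z)) =
      (α_ (T a X) (T b Y) (T c Z)).hom ≫ (𝟙 (T a X) ⊗ₘ dst b c Y Z) ≫ dst a (b + c) X (Y ⊗ Z)
  left_unit : ∀ (a : A) (X : C),
    (L.unit (𝟙_ C) ⊗ₘ 𝟙 (T a X)) ≫ dst 0 a (𝟙_ C) X ≫ L.map (0 + a) (λ_ X).hom =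
      (λ_ (T a X)).hom ≫ gradeCast T (zero_add a).symm X
  right_unit : ∀ (a : A) (X : C),
    (𝟙 (T a X) ⊗ₘ L.unit (𝟙_ C)) ≫ dst a 0 X (𝟙_ C) ≫ L.map (a + 0) (ρ_ X).hom =
      (ρ_ (T a X)).hom ≫ gradeCast T (add_zero a).symm X
  symmetry : ∀ (a b : A) (X Y : C),
    dst a b X Y ≫ L.map (a + b) (β_ X Y).hom ≫ gradeCast T (add_comm a b) (Y ⊗ X) =
      (β_ (T a X) (T b Y)).hom ≫ dst b a Y X

/-- The double strength `S` of the graded lifting `L` of `M` lies over the family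
`s X Y : M X ⊗ M Y ⟶ M (X ⊗ Y)`. -/
structure DoubleStrength.LiesOver {A : Type w} [AddCommMonoid A] [Preorder A] [AddLeftMono A]
    [AddRightMono A] {C : Type u} [Category.{v} C] [MonoidalCategory C] [SymmetricCategory C]
    {D : Type u} [Category.{v} D] [MonoidalCategory D]
    {T : A → C → C} {L : GradedMonad A C T} (S : DoubleStrength L) {U : C ⥤ D}
    {M : CategoryTheory.Monad D} (hL : IsGradedLifting L U M)
    (s : ∀ X Y : D, M.obj X ⊗ M.obj Y ⟶ M.obj (X ⊗ Y)) : Prop where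
  tensor_eq : ∀ X Y : C, U.obj (X ⊗ Y) = U.obj X ⊗ U.obj Y
  dst_eq : ∀ (a b : A) (X Y : C),
    U.map (S.dst a b X Y) =
      eqToHom ((tensor_eq (T a X) (T b Y)).trans (by rw [hL.obj_eq a X, hL.obj_eq b Y])) ≫
        s (U.obj X) (U.obj Y) ≫
        eqToHom ((hL.obj_eq (a + b) (X ⊗ Y)).trans (by rw [tensor_eq X Y])).symm

/-- The product monad `M × N` on `C × D`. -/
def prodMonad {C : Type u} [Category.{v} C] {D : Type u} [Category.{v} D]
    (M : CategoryTheory.Monad C) (N : CategoryTheory.Monad D) : CategoryTheory.Monad (C × D) where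
  toFunctor := M.toFunctor.prod N.toFunctor
  η := { app := fun X => (M.η.app X.1, N.η.app X.2)
         naturality := fun _ _ f => Prod.ext (M.η.naturality f.1) (N.η.naturality f.2) }
  μ := { app := fun X => (M.μ.app X.1, N.μ.app X.2)
         naturality := fun _ _ f => Prod.ext (M.μ.naturality f.1) (N.μ.naturality f.2) }
  assoc X := Prod.ext (M.assoc X.1) (N.assoc X.2)
  left_unit X := Prod.ext (M.left_unit X.1) (N.left_unit X.2)
  right_unit X := Prod.ext (M.right_unit X.1) (N.right_unit X.2)

end GradedMonads

/-! ### Finite products of measurable spaces -/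

instance measCartesian : CartesianMonoidalCategory MeasCat.{u} :=
  .ofChosenFiniteProducts
    ⟨asEmptyCone (MeasCat.of PUnit.{u + 1}),
      IsTerminal.ofUniqueHom (fun _ => ⟨fun _ => PUnit.unit, measurable_const⟩)
        (fun _ _ => rfl)⟩
    (fun X Y =>
      ⟨BinaryFan.mk (P := MeasCat.of (X × Y)) ⟨Prod.fst, measurable_fst⟩
          ⟨Prod.snd, measurable_snd⟩,
        BinaryFan.IsLimit.mk _ (fun f g => ⟨fun t => (f.1 t, g.1 t), f.2.prodMk g.2⟩)
          (fun _ _ => rfl) (fun _ _ => rfl)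
          (fun f g m hf hg => by subst hf hg; rfl)⟩)

instance measBraided : BraidedCategory MeasCat.{u} := .ofCartesianMonoidalCategory

/-! ### The sub-Giry monad -/

/-- The space of subprobability measures on `X`, with the coarsest σ-algebra making the
evaluations `μ ↦ μ S` (`S` measurable) measurable. -/
abbrev SubProb (X : Type u) [MeasurableSpace X] : Type u := {μ : Measure X // μ Set.univ ≤ 1}

instance {X : Type u} [MeasurableSpace X] (μ : SubProb X) : IsFiniteMeasure μ.1 :=
  ⟨μ.2.trans_lt ENNReal.one_lt_top⟩

/-- Push-forward of subprobability measures. -/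
def SubProb.map {X Y : Type u} [MeasurableSpace X] [MeasurableSpace Y] (f : X → Y)
    (hf : Measurable f) (μ : SubProb X) : SubProb Y :=
  ⟨μ.1.map f, by rw [Measure.map_apply hf MeasurableSet.univ]; exact μ.2⟩

/-- The Dirac measure as a subprobability measure. -/
def SubProb.dirac {X : Type u} [MeasurableSpace X] (x : X) : SubProb X :=
  ⟨Measure.dirac x, by simp⟩

/-- Averaging of subprobability measures: `join M S = ∫ μ S dM(μ)`. -/
def SubProb.join {X : Type u} [MeasurableSpace X] (M : SubProb (SubProb X)) : SubProb X :=
  ⟨M.1.bind Subtype.val, by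
    rw [Measure.bind_apply MeasurableSet.univ measurable_subtype_coe.aemeasurable]
    calc ∫⁻ μ, μ.1 Set.univ ∂M.1 ≤ ∫⁻ _, 1 ∂M.1 := lintegral_mono fun μ => μ.2
      _ ≤ 1 := by simpa using M.2⟩

/-- The product of two subprobability measures. -/
def SubProb.prod {X Y : Type u} [MeasurableSpace X] [MeasurableSpace Y] (μ : SubProb X)
    (ν : SubProb Y) : SubProb (X × Y) :=
  ⟨μ.1.prod ν.1, by
    rw [← Set.univ_prod_univ, Measure.prod_prod]
    exact mul_le_one' μ.2 ν.2⟩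

theorem SubProb.measurable_map {X Y : Type u} [MeasurableSpace X] [MeasurableSpace Y]
    (f : X → Y) (hf : Measurable f) : Measurable (SubProb.map f hf) :=
  ((Measure.measurable_map f hf).comp measurable_subtype_coe).subtype_mk

theorem SubProb.measurable_dirac {X : Type u} [MeasurableSpace X] :
    Measurable (SubProb.dirac : X → SubProb X) :=
  Measure.measurable_dirac.subtype_mk

theorem SubProb.measurable_join {X : Type u} [MeasurableSpace X] :
    Measurable (SubProb.join : SubProb (SubProb X) → SubProb X) :=
  ((Measure.measurable_bind' measurable_subtype_coe).comp measurable_subtype_coe).subtype_mk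

theorem SubProb.measurable_prod {X Y : Type u} [MeasurableSpace X] [MeasurableSpace Y] :
    Measurable (fun p : SubProb X × SubProb Y => SubProb.prod p.1 p.2) := by
  refine Measurable.subtype_mk ?_
  have : ∀ p : SubProb X × SubProb Y, IsFiniteMeasure (p.1.1.prod p.2.1) := fun p => inferInstance
  refine Measurable.measure_of_isPiSystem generateFrom_prod.symm isPiSystem_prod ?_ ?_
  · rintro _ ⟨s, hs, t, ht, rfl⟩
    simp_rw [Measure.prod_prod]
    exact ((Measure.measurable_coe hs).comp (measurable_subtype_coe.comp measurable_fst)).mul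
      ((Measure.measurable_coe ht).comp (measurable_subtype_coe.comp measurable_snd))
  · simp_rw [← Set.univ_prod_univ, Measure.prod_prod]
    exact ((Measure.measurable_coe .univ).comp (measurable_subtype_coe.comp measurable_fst)).mul
      ((Measure.measurable_coe .univ).comp (measurable_subtype_coe.comp measurable_snd))

theorem SubProb.join_apply {X : Type u} [MeasurableSpace X] (M : SubProb (SubProb X)) {S : Set X}
    (hS : MeasurableSet S) : (SubProb.join M).1 S = ∫⁻ μ, μ.1 S ∂M.1 :=
  Measure.bind_apply hS measurable_subtype_coe.aemeasurable

theorem SubProb.lintegral_join {X : Type u} [MeasurableSpace X] (M : SubProb (SubProb X))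
    {f : X → ℝ≥0∞} (hf : Measurable f) :
    ∫⁻ x, f x ∂(SubProb.join M).1 = ∫⁻ μ, ∫⁻ x, f x ∂μ.1 ∂M.1 :=
  Measure.lintegral_bind measurable_subtype_coe.aemeasurable hf.aemeasurable

theorem SubProb.measurable_eval {X : Type u} [MeasurableSpace X] {S : Set X}
    (hS : MeasurableSet S) : Measurable fun μ : SubProb X => μ.1 S :=
  (Measure.measurable_coe hS).comp measurable_subtype_coe

/-- The sub-Giry monad `𝒢` on measurable spaces. -/
def subGiry : CategoryTheory.Monad MeasCat.{u} where
  obj X := MeasCat.of (SubProb X)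
  map f := ⟨SubProb.map f.1 f.2, SubProb.measurable_map f.1 f.2⟩
  map_id _ := Subtype.ext <| funext fun _ => Subtype.ext Measure.map_id
  map_comp f g := Subtype.ext <| funext fun _ => Subtype.ext (Measure.map_map g.2 f.2).symm
  η :=
    { app := fun _ => ⟨SubProb.dirac, SubProb.measurable_dirac⟩
      naturality := fun _ _ f =>
        Subtype.ext <| funext fun x => Subtype.ext (Measure.map_dirac' f.2 x).symm }
  μ :=
    { app := fun _ => ⟨SubProb.join, SubProb.measurable_join⟩
      naturality := fun X Y f => Subtype.ext <| funext fun (M : SubProb (SubProb X)) =>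
        Subtype.ext <| Measure.ext fun S hS => by
          change (SubProb.join (SubProb.map _ (SubProb.measurable_map f.1 f.2) M)).1 S =
            ((SubProb.join M).1.map f.1) S
          rw [SubProb.join_apply _ hS, Measure.map_apply f.2 hS, SubProb.join_apply _ (f.2 hS)]
          refine (lintegral_map (SubProb.measurable_eval hS)
            (SubProb.measurable_map f.1 f.2)).trans (lintegral_congr fun μ => ?_)
          exact Measure.map_apply f.2 hS }
  assoc X := Subtype.ext <| funext fun (M : SubProb (SubProb (SubProb X))) =>
    Subtype.ext <| Measure.ext fun S hS => by
      change (SubProb.join (SubProb.map _ SubProb.measurable_join M)).1 S =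
        (SubProb.join (SubProb.join M)).1 S
      rw [SubProb.join_apply _ hS, SubProb.join_apply _ hS,
        SubProb.lintegral_join _ (SubProb.measurable_eval hS)]
      exact (lintegral_map (SubProb.measurable_eval hS) SubProb.measurable_join).trans
        (lintegral_congr fun μ => SubProb.join_apply _ hS)
  left_unit X := Subtype.ext <| funext fun (μ : SubProb X) =>
    Subtype.ext <| Measure.ext fun S hS => by
      change (SubProb.join (SubProb.dirac μ)).1 S = μ.1 S
      rw [SubProb.join_apply _ hS]
      exact lintegral_dirac' _ (SubProb.measurable_eval hS)
  right_unit X := Subtype.ext <| funext fun (μ : SubProb X) =>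
    Subtype.ext <| Measure.ext fun S hS => by
      change (SubProb.join (SubProb.map _ SubProb.measurable_dirac μ)).1 S = μ.1 S
      rw [SubProb.join_apply _ hS]
      refine (lintegral_map (SubProb.measurable_eval hS) SubProb.measurable_dirac).trans ?_
      simp [SubProb.dirac, Measure.dirac_apply' _ hS, lintegral_indicator hS]

/-- The Kleisli extension of the sub-Giry monad is `f^♯(μ)(S) = ∫ f(x)(S) dμ(x)`. -/
theorem subGiry_kleisliExt_apply {X Y : MeasCat.{u}} (f : X ⟶ subGiry.obj Y)
    (μ : SubProb X) {S : Set Y} (hS : MeasurableSet S) :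
    ((kleisliExt subGiry f).1 μ).1 S = ∫⁻ x, (f.1 x).1 S ∂μ.1 :=
  (SubProb.join_apply _ hS).trans (lintegral_map (SubProb.measurable_eval hS) f.2)

/-- The double strength `𝒢 X × 𝒢 Y ⟶ 𝒢 (X × Y)` of the sub-Giry monad: product measures. -/
def subGiryDst (X Y : MeasCat.{u}) : subGiry.obj X ⊗ subGiry.obj Y ⟶ subGiry.obj (X ⊗ Y) :=
  ⟨fun p : SubProb X × SubProb Y => SubProb.prod p.1 p.2, SubProb.measurable_prod⟩

/-- The monad `𝒢 × 𝒢` on `Meas × Meas`. -/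
def subGiryPair : CategoryTheory.Monad (MeasCat.{u} × MeasCat.{u}) := prodMonad subGiry subGiry

/-- The componentwise double strength of `𝒢 × 𝒢`. -/
def subGiryPairDst (X Y : MeasCat.{u} × MeasCat.{u}) :
    subGiryPair.obj X ⊗ subGiryPair.obj Y ⟶ subGiryPair.obj (X ⊗ Y) :=
  (subGiryDst X.1 Y.1, subGiryDst X.2 Y.2)

/-! ### The category of spans of measurable spaces -/

/-- A span `left ⟵ apex ⟶ right` of measurable spaces. -/
structure SpanMeas : Type (u + 1) where
  left : MeasCat.{u}
  right : MeasCat.{u}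
  apex : MeasCat.{u}
  ρ₁ : apex ⟶ left
  ρ₂ : apex ⟶ right

/-- A morphism of spans. -/
@[ext]
structure SpanMeas.Hom (Φ Ψ : SpanMeas.{u}) : Type u where
  left : Φ.left ⟶ Ψ.left
  right : Φ.right ⟶ Ψ.right
  apex : Φ.apex ⟶ Ψ.apex
  w₁ : Φ.ρ₁ ≫ left = apex ≫ Ψ.ρ₁
  w₂ : Φ.ρ₂ ≫ right = apex ≫ Ψ.ρ₂

instance : Category.{u} SpanMeas.{u} where
  Hom := SpanMeas.Hom
  id Φ := ⟨𝟙 _, 𝟙 _, 𝟙 _, rfl, rfl⟩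
  comp f g := ⟨f.left ≫ g.left, f.right ≫ g.right, f.apex ≫ g.apex,
    by rw [← Category.assoc, f.w₁, Category.assoc, g.w₁, Category.assoc],
    by rw [← Category.assoc, f.w₂, Category.assoc, g.w₂, Category.assoc]⟩

/-- The forgetful functor `U : Span(Meas) ⥤ Meas × Meas`. -/
def SpanMeas.forget : SpanMeas.{u} ⥤ MeasCat.{u} × MeasCat.{u} where
  obj Φ := (Φ.left, Φ.right)
  map f := (f.left, f.right)

/-- The product of two spans, formed componentwise. -/
def SpanMeas.prod (Φ Ψ : SpanMeas.{u}) : SpanMeas.{u} where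
  left := Φ.left ⊗ Ψ.left
  right := Φ.right ⊗ Ψ.right
  apex := Φ.apex ⊗ Ψ.apex
  ρ₁ := Φ.ρ₁ ⊗ₘ Ψ.ρ₁
  ρ₂ := Φ.ρ₂ ⊗ₘ Ψ.ρ₂

/-- Componentwise finite products of spans. -/
instance spanCartesian : CartesianMonoidalCategory SpanMeas.{u} :=
  .ofChosenFiniteProducts
    ⟨asEmptyCone ⟨𝟙_ _, 𝟙_ _, 𝟙_ _, 𝟙 _, 𝟙 _⟩,
      IsTerminal.ofUniqueHom
        (fun Φ => ⟨CartesianMonoidalCategory.toUnit Φ.left, CartesianMonoidalCategory.toUnit Φ.right,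
          CartesianMonoidalCategory.toUnit Φ.apex, rfl, rfl⟩)
        (fun _ _ => rfl)⟩
    (fun Φ Ψ =>
      ⟨BinaryFan.mk (P := SpanMeas.prod Φ Ψ)
          ⟨CartesianMonoidalCategory.fst _ _, CartesianMonoidalCategory.fst _ _,
            CartesianMonoidalCategory.fst _ _, rfl, rfl⟩
          ⟨CartesianMonoidalCategory.snd _ _, CartesianMonoidalCategory.snd _ _,
            CartesianMonoidalCategory.snd _ _, rfl, rfl⟩,
        BinaryFan.IsLimit.mk _
          (fun f g => ⟨CartesianMonoidalCategory.lift f.left g.left,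
            CartesianMonoidalCategory.lift f.right g.right,
            CartesianMonoidalCategory.lift f.apex g.apex,
            Subtype.ext <| funext fun x => Prod.ext
              (congrFun (congrArg Subtype.val f.w₁) x) (congrFun (congrArg Subtype.val g.w₁) x),
            Subtype.ext <| funext fun x => Prod.ext
              (congrFun (congrArg Subtype.val f.w₂) x) (congrFun (congrArg Subtype.val g.w₂) x)⟩)
          (fun _ _ => rfl) (fun _ _ => rfl)
          (fun f g m hf hg => by subst hf hg; rfl)⟩)

instance spanBraided : BraidedCategory SpanMeas.{u} := .ofCartesianMonoidalCategory

/-! ### Divergences -/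

/-- A divergence: a family of functions `𝒢 X × 𝒢 X → [-∞, ∞]`. -/
def Divergence : Type (u + 1) := ∀ X : MeasCat.{u}, SubProb X → SubProb X → EReal

/-- `b * f (a / b)`, with the conventions `0 * f (0 / 0) = 0` and
`0 * f (a / 0) = lim_{t → 0+} t * f (a / t)` for `a > 0`
(for a weight function `f` this limit exists in `[0, ∞]`). -/
def perspective (f : ℝ≥0 → ℝ≥0) (a b : ℝ≥0) : ℝ≥0∞ :=
  if b ≠ 0 then ((b * f (a / b) : ℝ≥0) : ℝ≥0∞)
  else if a = 0 then 0
  else Filter.limsup (fun t : ℝ≥0 => ((t * f (a / t) : ℝ≥0) : ℝ≥0∞)) (𝓝[>] 0)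

/-- The `f`-divergence `∫ μ₂(x) f(μ₁(x) / μ₂(x)) dx` for a nonnegative weight function `f`, where
the densities are taken with respect to the common dominating measure `μ₁ + μ₂`. -/
def fDivergence (f : ℝ≥0 → ℝ≥0) {X : MeasCat.{u}} (μ₁ μ₂ : SubProb X) : ℝ≥0∞ :=
  ∫⁻ x, perspective f (μ₁.1.rnDeriv (μ₁.1 + μ₂.1) x).toNNReal
    (μ₂.1.rnDeriv (μ₁.1 + μ₂.1) x).toNNReal ∂(μ₁.1 + μ₂.1)

/-- The divergence for differential privacy: the `f`-divergence with weight function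
`t ↦ max 0 (1 - e^ε t)`. -/
def dpDivergence (ε : ℝ≥0) : Divergence.{u} := fun _ μ₁ μ₂ =>
  (fDivergence (fun t => (1 - Real.exp ε * t).toNNReal) μ₁ μ₂ : EReal)

/-- The Rényi divergence of order `α > 1`:
`1 / (α - 1) * log ∫ μ₂(x) (μ₁(x) / μ₂(x)) ^ α dx`. -/
def renyiDivergence (α : ℝ) : Divergence.{u} := fun _ μ₁ μ₂ =>
  ((1 / (α - 1) : ℝ) : EReal) * ENNReal.log (fDivergence (fun t => t ^ α) μ₁ μ₂)

/-- The divergence for zero-concentrated differential privacy: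
`sup_{1 < α} (D^α(μ₁ ‖ μ₂) - ξ) / α`. -/
def zcdpDivergence (ξ : ℝ≥0) : Divergence.{u} := fun X μ₁ μ₂ =>
  ⨆ (α : ℝ) (_ : 1 < α),
    ((1 / α : ℝ) : EReal) * (renyiDivergence α X μ₁ μ₂ - ((ξ : ℝ) : EReal))

/-- The divergence for truncated concentrated differential privacy:
`sup_{1 < α < ω} D^α(μ₁ ‖ μ₂) / α`. -/
def tcdpDivergence (ω : ℝ) : Divergence.{u} := fun X μ₁ μ₂ =>
  ⨆ (α : ℝ) (_ : 1 < α ∧ α < ω), ((1 / α : ℝ) : EReal) * renyiDivergence α X μ₁ μ₂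

/-! ### Approximate span-liftings -/

/-- The space `W(Φ, Δ, δ)` of pairs of subprobability measures on `Φ` with divergence at most `δ`,
as a subspace of `𝒢 Φ × 𝒢 Φ`. -/
abbrev Witness (Δ : Divergence.{u}) (δ : EReal) (Φ : MeasCat.{u}) : Type u :=
  {p : SubProb Φ × SubProb Φ // Δ Φ p.1 p.2 ≤ δ}

/-- The action on objects of the approximate span-lifting:
`(X, Y, Φ, ρ₁, ρ₂) ↦ (𝒢 X, 𝒢 Y, W(Φ, Δ, δ), 𝒢 ρ₁ ∘ π₁, 𝒢 ρ₂ ∘ π₂)`. -/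
def spanLift (Δ : Divergence.{u}) (δ : EReal) (Φ : SpanMeas.{u}) : SpanMeas.{u} where
  left := subGiry.obj Φ.left
  right := subGiry.obj Φ.right
  apex := MeasCat.of (Witness Δ δ Φ.apex)
  ρ₁ := ⟨fun p : Witness Δ δ Φ.apex => (subGiry.map Φ.ρ₁).1 p.1.1,
    (subGiry.map Φ.ρ₁).2.comp (measurable_fst.comp measurable_subtype_coe)⟩
  ρ₂ := ⟨fun p : Witness Δ δ Φ.apex => (subGiry.map Φ.ρ₂).1 p.1.2,
    (subGiry.map Φ.ρ₂).2.comp (measurable_snd.comp measurable_subtype_coe)⟩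

/-- The first projection `W(Φ, Δ, δ) ⟶ 𝒢 Φ`. -/
def spanLift.π₁ (Δ : Divergence.{u}) (δ : EReal) (Φ : SpanMeas.{u}) :
    (spanLift Δ δ Φ).apex ⟶ subGiry.obj Φ.apex :=
  ⟨fun p : Witness Δ δ Φ.apex => p.1.1, measurable_fst.comp measurable_subtype_coe⟩

/-- The second projection `W(Φ, Δ, δ) ⟶ 𝒢 Φ`. -/
def spanLift.π₂ (Δ : Divergence.{u}) (δ : EReal) (Φ : SpanMeas.{u}) :
    (spanLift Δ δ Φ).apex ⟶ subGiry.obj Φ.apex :=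
  ⟨fun p : Witness Δ δ Φ.apex => p.1.2, measurable_snd.comp measurable_subtype_coe⟩

/-- A graded monad with double strength whose object parts are the approximate span-liftings for
the divergences `Δ a` and the bounds `δ a` carries the canonical structure maps on apexes
(the remaining components are prescribed by being a lifting of `𝒢 × 𝒢`). -/
structure HasCanonicalApex {A : Type w} [AddCommMonoid A] [Preorder A] [AddLeftMono A]
    [AddRightMono A] {Δ : A → Divergence.{u}} {δ : A → EReal}
    {L : GradedMonad A SpanMeas.{u} (fun a => spanLift (Δ a) (δ a))}
    (S : DoubleStrength L) : Prop where
  map : ∀ (a : A) {Φ Ψ : SpanMeas.{u}} (f : Φ ⟶ Ψ) (p : Witness (Δ a) (δ a) Φ.apex),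
    ((L.map a f).apex.1 p).1 = ((subGiry.map f.apex).1 p.1.1, (subGiry.map f.apex).1 p.1.2)
  unit : ∀ (Φ : SpanMeas.{u}) (x : Φ.apex),
    ((L.unit Φ).apex.1 x).1 = (SubProb.dirac x, SubProb.dirac x)
  klift : ∀ (a : A) {b : A} {Φ Ψ : SpanMeas.{u}} (f : Φ ⟶ spanLift (Δ b) (δ b) Ψ)
    (p : Witness (Δ a) (δ a) Φ.apex),
    ((L.klift a f).apex.1 p).1 =
      ((kleisliExt subGiry (f.apex ≫ spanLift.π₁ (Δ b) (δ b) Ψ)).1 p.1.1,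
        (kleisliExt subGiry (f.apex ≫ spanLift.π₂ (Δ b) (δ b) Ψ)).1 p.1.2)
  incl : ∀ {a b : A} (h : a ≤ b) (Φ : SpanMeas.{u}) (p : Witness (Δ a) (δ a) Φ.apex),
    ((L.incl h Φ).apex.1 p).1 = p.1
  dst : ∀ (a b : A) (Φ Ψ : SpanMeas.{u}) (p : Witness (Δ a) (δ a) Φ.apex)
    (q : Witness (Δ b) (δ b) Ψ.apex),
    ((S.dst a b Φ Ψ).apex.1 (p, q)).1 =
      (SubProb.prod p.1.1 q.1.1, SubProb.prod p.1.2 q.1.2)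

/-- The approximate span-liftings for the divergences `Δ a` and the bounds `δ a`, `a ∈ A`, form an
`A`-graded lifting of `𝒢 × 𝒢` along `U : Span(Meas) ⥤ Meas × Meas` with a double strength lying
over that of `𝒢 × 𝒢`. -/
def IsGradedLiftingWithDoubleStrength {A : Type w} [AddCommMonoid A] [Preorder A] [AddLeftMono A]
    [AddRightMono A] (Δ : A → Divergence.{u}) (δ : A → EReal) : Prop :=
  ∃ (L : GradedMonad A SpanMeas.{u} (fun a => spanLift (Δ a) (δ a))) (S : DoubleStrength L)
    (hL : IsGradedLifting L SpanMeas.forget subGiryPair),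
    S.LiesOver hL subGiryPairDst ∧ HasCanonicalApex S

end SpanLifting

namespace SpanLifting

/-! ### Kleisli extensions -/

section Kleisli

variable {C : Type u} [Category.{v} C] (M : CategoryTheory.Monad C) {X Y Z : C}

/-! A morphism into a span-lifting is determined by its left and right legs and the two projections
of its apex map (`spanLift_hom_ext`), so every axiom splits into four identities about `𝒢` itself.
All that depends on the divergence is that the structure maps respect the witness bounds, and for
this the three conditions of `IsComposable` suffice. Push-forward is Kleisli extension along a Dirac
kernel, and `μ ⊗ ν` is the Kleisli extension of `x ↦ dirac x ⊗ ν`; hence functoriality and the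
double strength also come from composability.

Composability is proved by duality: a divergence bound is an inequality between integrals of test
functions. Such an inequality passes through `∫⁻ y, t y ∂(f x)` one `x` at a time, so the densities
of the mixtures are never computed and the kernels need no densities measurable in `x`.

For DP the tests are functions with values in `[0, 1]`, and indicators already suffice
(`lintegral_le_of_hockeyStick`, `hockeyStick_le`). For Rényi they come from Young's inequality
(`young_renyiIntegral`, `renyiIntegral_le`); optimizing a scale factor pointwise makes the Rényi
integral submultiplicative (`renyiIntegral_kleisliExt_le`), and the logarithm turns this into
additivity. The zCDP and tCDP bounds are families of bounds `D^α ≤ α ρ + ξ` (with `ξ = 0` for tCDP),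
whose right sides are additive in the grade for each `α`. -/

theorem unit_comp_kleisliExt (f : X ⟶ M.obj Y) : M.η.app X ≫ kleisliExt M f = f := by
  have := M.η.naturality f
  simp only [Functor.id_map] at this
  simp [kleisliExt, ← reassoc_of% this]

theorem kleisliExt_unit (X : C) : kleisliExt M (M.η.app X) = 𝟙 (M.obj X) :=
  M.right_unit X

theorem kleisliExt_comp_unit (f : X ⟶ Y) : kleisliExt M (f ≫ M.η.app Y) = M.map f := by
  simp [kleisliExt]

theorem kleisliExt_comp_kleisliExt (f : X ⟶ M.obj Y) (g : Y ⟶ M.obj Z) :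
    kleisliExt M (f ≫ kleisliExt M g) = kleisliExt M f ≫ kleisliExt M g := by
  have := M.μ.naturality g
  simp only [Functor.comp_map] at this
  simp [kleisliExt, M.assoc, reassoc_of% this]

theorem kleisliExt_comp_map (f : X ⟶ M.obj Y) (g : Y ⟶ Z) :
    kleisliExt M (f ≫ M.map g) = kleisliExt M f ≫ M.map g := by
  rw [← kleisliExt_comp_unit M g, kleisliExt_comp_kleisliExt]

theorem map_comp_kleisliExt (f : X ⟶ Y) (g : Y ⟶ M.obj Z) :
    M.map f ≫ kleisliExt M g = kleisliExt M (f ≫ g) := by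
  simp [kleisliExt]

end Kleisli

/-! ### The double strength of the sub-Giry monad -/

theorem subGiry_ext {X Y : MeasCat.{u}} {f g : X ⟶ subGiry.obj Y}
    (h : ∀ x, (f.1 x).1 = (g.1 x).1) : f = g :=
  Subtype.ext <| funext fun x => Subtype.ext (h x)

theorem subGiryDst_naturality {X X' Y Y' : MeasCat.{u}} (f : X ⟶ X') (g : Y ⟶ Y') :
    (subGiry.map f ⊗ₘ subGiry.map g) ≫ subGiryDst X' Y' =
      subGiryDst X Y ≫ subGiry.map (f ⊗ₘ g) :=
  subGiry_ext fun (p : SubProb X × SubProb Y) =>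
    Measure.map_prod_map p.1.1 p.2.1 f.2 g.2

theorem subGiryDst_unit (X Y : MeasCat.{u}) :
    (subGiry.η.app X ⊗ₘ subGiry.η.app Y) ≫ subGiryDst X Y = subGiry.η.app (X ⊗ Y) :=
  subGiry_ext fun _ => Measure.dirac_prod_dirac

/-- A product of finite measures is determined by its values on rectangles, and there the integrand
is a product of a function of `x` and a function of `y`, so the double integral factors. -/
theorem subGiryDst_kleisliExt {X X' Y Y' : MeasCat.{u}} (f : X ⟶ subGiry.obj X')
    (g : Y ⟶ subGiry.obj Y') :
    (kleisliExt subGiry f ⊗ₘ kleisliExt subGiry g) ≫ subGiryDst X' Y' =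
      subGiryDst X Y ≫ kleisliExt subGiry ((f ⊗ₘ g) ≫ subGiryDst X' Y') := by
  refine subGiry_ext fun (p : SubProb X × SubProb Y) => ?_
  change ((kleisliExt subGiry f).1 p.1).1.prod ((kleisliExt subGiry g).1 p.2).1 =
    ((kleisliExt subGiry ((f ⊗ₘ g) ≫ subGiryDst X' Y')).1 (SubProb.prod p.1 p.2)).1
  have prod_eq (μ : SubProb X') (ν : SubProb Y') (τ : Measure (X' × Y'))
      (h : ∀ s t, MeasurableSet s → MeasurableSet t → τ (s ×ˢ t) = μ.1 s * ν.1 t) :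
      μ.1.prod ν.1 = τ := Measure.prod_eq h
  refine prod_eq _ _ _ fun s t hs ht => ?_
  refine (subGiry_kleisliExt_apply _ _ (hs.prod ht)).trans ?_
  refine .trans ?_ (congrArg₂ (· * ·) (subGiry_kleisliExt_apply f p.1 hs)
    (subGiry_kleisliExt_apply g p.2 ht)).symm
  have hf : Measurable fun x => (f.1 x).1 s := (SubProb.measurable_eval hs).comp f.2
  have hg : Measurable fun y => (g.1 y).1 t := (SubProb.measurable_eval ht).comp g.2
  refine .trans ?_ (lintegral_prod_mul hf.aemeasurable hg.aemeasurable)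
  refine lintegral_congr fun z => ?_
  have prod_prod (μ : SubProb X') (ν : SubProb Y') : (μ.1.prod ν.1) (s ×ˢ t) = μ.1 s * ν.1 t :=
    Measure.prod_prod s t
  exact prod_prod _ _

theorem subGiryDst_associativity (X Y Z : MeasCat.{u}) :
    (subGiryDst X Y ⊗ₘ 𝟙 (subGiry.obj Z)) ≫ subGiryDst (X ⊗ Y) Z ≫ subGiry.map (α_ X Y Z).hom =
      (α_ (subGiry.obj X) (subGiry.obj Y) (subGiry.obj Z)).hom ≫
        (𝟙 (subGiry.obj X) ⊗ₘ subGiryDst Y Z) ≫ subGiryDst X (Y ⊗ Z) :=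
  subGiry_ext fun (p : (SubProb X × SubProb Y) × SubProb Z) =>
    Measure.prodAssoc_prod (μ := p.1.1.1) (ν := p.1.2.1) (τ := p.2.1)

theorem subGiryDst_left_unit (X : MeasCat.{u}) :
    (subGiry.η.app (𝟙_ MeasCat.{u}) ⊗ₘ 𝟙 (subGiry.obj X)) ≫ subGiryDst (𝟙_ _) X ≫
      subGiry.map (λ_ X).hom = (λ_ (subGiry.obj X)).hom :=
  subGiry_ext fun (p : PUnit.{u + 1} × SubProb X) => by
    change ((Measure.dirac p.1).prod p.2.1).snd = p.2.1
    rw [Measure.snd_prod]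

theorem subGiryDst_right_unit (X : MeasCat.{u}) :
    (𝟙 (subGiry.obj X) ⊗ₘ subGiry.η.app (𝟙_ MeasCat.{u})) ≫ subGiryDst X (𝟙_ _) ≫
      subGiry.map (ρ_ X).hom = (ρ_ (subGiry.obj X)).hom :=
  subGiry_ext fun (p : SubProb X × PUnit.{u + 1}) => by
    change (p.1.1.prod (Measure.dirac p.2)).fst = p.1.1
    rw [Measure.fst_prod]

theorem subGiryDst_symmetry (X Y : MeasCat.{u}) :
    subGiryDst X Y ≫ subGiry.map (β_ X Y).hom =
      (β_ (subGiry.obj X) (subGiry.obj Y)).hom ≫ subGiryDst Y X :=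
  subGiry_ext fun (p : SubProb X × SubProb Y) =>
    Measure.prod_swap (μ := p.1.1) (ν := p.2.1)

/-- The kernel `x ↦ dirac x ⊗ ν`. -/
def diracProd (X : MeasCat.{u}) {Y : MeasCat.{u}} (ν : SubProb Y) : X ⟶ subGiry.obj (X ⊗ Y) :=
  ⟨fun x => SubProb.prod (SubProb.dirac x) ν,
    SubProb.measurable_prod.comp (SubProb.measurable_dirac.prodMk measurable_const)⟩

/-- In push-forward form the divergence between two such kernels at `x` is controlled by that of the
original measures on `Y`, through `IsComposable.map`. -/
theorem diracProd_apply {X Y : MeasCat.{u}} (ν : SubProb Y) (x : X) :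
    (diracProd X ν).1 x =
      (subGiry.map (Y := X ⊗ Y) ⟨Prod.mk x, measurable_prodMk_left⟩).1 ν :=
  Subtype.ext (Measure.dirac_prod x)

/-- This is integration over sections. It reduces the double strength bound to composability. -/
theorem kleisliExt_diracProd {X Y : MeasCat.{u}} (μ : SubProb X) (ν : SubProb Y) :
    (kleisliExt subGiry (diracProd X ν)).1 μ = SubProb.prod μ ν := by
  refine Subtype.ext (Measure.ext fun S hS => ?_)
  refine (subGiry_kleisliExt_apply _ μ hS).trans ?_
  refine .trans (lintegral_congr fun x => ?_) (Measure.prod_apply (μ := μ.1) (ν := ν.1) hS).symm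
  rw [diracProd_apply]
  exact Measure.map_apply measurable_prodMk_left hS

/-! ### Morphisms into an approximate span-lifting -/

section Lift

variable {Δ : Divergence.{u}} {δ : EReal}

/-- The morphism into a witness space with the given components. -/
def witnessLift {X Φ : MeasCat.{u}} (f g : X ⟶ subGiry.obj Φ)
    (h : ∀ x, Δ Φ (f.1 x) (g.1 x) ≤ δ) : X ⟶ MeasCat.of (Witness Δ δ Φ) :=
  ⟨fun x => ⟨(f.1 x, g.1 x), h x⟩, (f.2.prodMk g.2).subtype_mk⟩

/-- The witness space is a subspace of `𝒢 Φ × 𝒢 Φ`, so its two projections are jointly monic; the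
proof of the bound carries no data. -/
theorem spanLift_hom_ext {Φ Ψ : SpanMeas.{u}} {f g : Φ ⟶ spanLift Δ δ Ψ}
    (hl : f.left = g.left) (hr : f.right = g.right)
    (h₁ : f.apex ≫ spanLift.π₁ Δ δ Ψ = g.apex ≫ spanLift.π₁ Δ δ Ψ)
    (h₂ : f.apex ≫ spanLift.π₂ Δ δ Ψ = g.apex ≫ spanLift.π₂ Δ δ Ψ) : f = g :=
  SpanMeas.Hom.ext hl hr <| Subtype.ext <| funext fun x => Subtype.ext <| Prod.ext
    (congrFun (congrArg Subtype.val h₁) x) (congrFun (congrArg Subtype.val h₂) x)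

end Lift

section Cast

variable {A : Type w} {Δ : A → Divergence.{u}} {δ : A → EReal} {a b : A} {Φ Ψ : SpanMeas.{u}}

/-- Morphisms into span-liftings at equal grades agree up to the identification of the grades if
their components do. -/
theorem eq_comp_gradeCast {f : Φ ⟶ spanLift (Δ b) (δ b) Ψ} {g : Φ ⟶ spanLift (Δ a) (δ a) Ψ}
    (h : a = b) (hl : f.left = g.left) (hr : f.right = g.right)
    (h₁ : f.apex ≫ spanLift.π₁ _ _ Ψ = g.apex ≫ spanLift.π₁ _ _ Ψ)
    (h₂ : f.apex ≫ spanLift.π₂ _ _ Ψ = g.apex ≫ spanLift.π₂ _ _ Ψ) :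
    f = g ≫ gradeCast (fun a => spanLift (Δ a) (δ a)) h Ψ := by
  subst h
  exact (spanLift_hom_ext hl hr h₁ h₂).trans (Category.comp_id g).symm

end Cast

/-! ### Composable divergences -/

section Composable

variable {A : Type w} [AddCommMonoid A] [Preorder A]

/-- The conditions on a graded family of divergences under which the approximate span-liftings
form a graded monad: reflexivity, monotonicity in the grade, and graded composability. -/
structure IsComposable (Δ : A → Divergence.{u}) (δ : A → EReal) : Prop where
  refl : ∀ {X : MeasCat.{u}} (x : X), Δ 0 X (SubProb.dirac x) (SubProb.dirac x) ≤ δ 0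
  mono : ∀ {a b : A}, a ≤ b → ∀ {X : MeasCat.{u}} {μ ν : SubProb X},
    Δ a X μ ν ≤ δ a → Δ b X μ ν ≤ δ b
  comp : ∀ {a b : A} {X Y : MeasCat.{u}} (f g : X ⟶ subGiry.obj Y) {μ ν : SubProb X},
    Δ a X μ ν ≤ δ a → (∀ x, Δ b Y (f.1 x) (g.1 x) ≤ δ b) →
      Δ (a + b) Y ((kleisliExt subGiry f).1 μ) ((kleisliExt subGiry g).1 ν) ≤ δ (a + b)

namespace IsComposable

variable {Δ : A → Divergence.{u}} {δ : A → EReal}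

/-- The Dirac kernel compared with itself costs grade `0`, so composing with it leaves the grade `a
+ 0 = a`. -/
theorem map (H : IsComposable Δ δ) {a : A} {X Y : MeasCat.{u}} (f : X ⟶ Y) {μ ν : SubProb X} (h : Δ a X μ ν ≤ δ a) :
    Δ a Y ((subGiry.map f).1 μ) ((subGiry.map f).1 ν) ≤ δ a := by
  have := H.comp (f ≫ subGiry.η.app Y) (f ≫ subGiry.η.app Y) h fun x => H.refl (f.1 x)
  rwa [kleisliExt_comp_unit, add_zero] at this

theorem prod (H : IsComposable Δ δ) {a b : A} {X Y : MeasCat.{u}} {μ₁ μ₂ : SubProb X} {ν₁ ν₂ : SubProb Y}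
    (h : Δ a X μ₁ μ₂ ≤ δ a) (h' : Δ b Y ν₁ ν₂ ≤ δ b) :
    Δ (a + b) (X ⊗ Y) (SubProb.prod μ₁ ν₁) (SubProb.prod μ₂ ν₂) ≤ δ (a + b) := by
  rw [← kleisliExt_diracProd, ← kleisliExt_diracProd]
  refine H.comp _ _ h fun x => ?_
  rw [diracProd_apply, diracProd_apply]
  exact H.map _ h'

/-- The graded monad of approximate span-liftings. -/
def gradedMonad [AddLeftMono A] [AddRightMono A] (H : IsComposable Δ δ) :
    GradedMonad A SpanMeas.{u} (fun a => spanLift (Δ a) (δ a)) where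
  map a _ _ f :=
    { left := subGiry.map f.left
      right := subGiry.map f.right
      apex := witnessLift (spanLift.π₁ _ _ _ ≫ subGiry.map f.apex)
        (spanLift.π₂ _ _ _ ≫ subGiry.map f.apex) fun p => H.map f.apex p.2
      w₁ := congrArg (spanLift.π₁ _ _ _ ≫ ·)
        (by simpa only [Functor.map_comp] using congrArg subGiry.map f.w₁)
      w₂ := congrArg (spanLift.π₂ _ _ _ ≫ ·)
        (by simpa only [Functor.map_comp] using congrArg subGiry.map f.w₂) }
  unit Φ :=
    { left := subGiry.η.app Φ.left
      right := subGiry.η.app Φ.right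
      apex := witnessLift (subGiry.η.app Φ.apex) (subGiry.η.app Φ.apex) fun x => H.refl x
      w₁ := subGiry.η.naturality Φ.ρ₁
      w₂ := subGiry.η.naturality Φ.ρ₂ }
  klift a b Φ Ψ f :=
    { left := kleisliExt subGiry f.left
      right := kleisliExt subGiry f.right
      apex := witnessLift
        (spanLift.π₁ _ _ _ ≫ kleisliExt subGiry (f.apex ≫ spanLift.π₁ _ _ _))
        (spanLift.π₂ _ _ _ ≫ kleisliExt subGiry (f.apex ≫ spanLift.π₂ _ _ _))
        fun p => H.comp _ _ p.2 fun x => (f.apex.1 x).2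
      -- After cancelling `π₁`, the square is the chain `𝒢ρ₁ ≫ (f.left)^♯ = (ρ₁ ≫ f.left)^♯ =
      -- (f.apex ≫ π₁ ≫ 𝒢ρ₁')^♯ = (f.apex ≫ π₁)^♯ ≫ 𝒢ρ₁'`.
      w₁ := congrArg (spanLift.π₁ _ _ _ ≫ ·) ((map_comp_kleisliExt _ _ _).trans
        ((congrArg _ f.w₁).trans (kleisliExt_comp_map subGiry (f.apex ≫ spanLift.π₁ _ _ _) _)))
      w₂ := congrArg (spanLift.π₂ _ _ _ ≫ ·) ((map_comp_kleisliExt _ _ _).trans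
        ((congrArg _ f.w₂).trans (kleisliExt_comp_map subGiry (f.apex ≫ spanLift.π₂ _ _ _) _))) }
  incl h Φ :=
    { left := 𝟙 (subGiry.obj Φ.left)
      right := 𝟙 (subGiry.obj Φ.right)
      apex := witnessLift (spanLift.π₁ _ _ _) (spanLift.π₂ _ _ _) fun p => H.mono h p.2
      w₁ := rfl
      w₂ := rfl }
  map_id a X := by
    have h := subGiry.map_id X.apex
    exact spanLift_hom_ext (subGiry.map_id _) (subGiry.map_id _)
      (congrArg (spanLift.π₁ _ _ _ ≫ ·) h) (congrArg (spanLift.π₂ _ _ _ ≫ ·) h)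
  map_comp a X Y Z f g := by
    have h := subGiry.map_comp f.apex g.apex
    exact spanLift_hom_ext (subGiry.map_comp _ _) (subGiry.map_comp _ _)
      (congrArg (spanLift.π₁ _ _ _ ≫ ·) h) (congrArg (spanLift.π₂ _ _ _ ≫ ·) h)
  incl_naturality h X Y f := spanLift_hom_ext rfl rfl rfl rfl
  incl_refl a X := spanLift_hom_ext rfl rfl rfl rfl
  incl_trans h h' X := spanLift_hom_ext rfl rfl rfl rfl
  klift_incl a b c h X Y f := spanLift_hom_ext rfl rfl rfl rfl
  incl_klift h X Y f := spanLift_hom_ext rfl rfl rfl rfl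
  unit_klift f := eq_comp_gradeCast _ (unit_comp_kleisliExt subGiry f.left)
    (unit_comp_kleisliExt subGiry f.right)
    (unit_comp_kleisliExt subGiry (f.apex ≫ spanLift.π₁ _ _ _))
    (unit_comp_kleisliExt subGiry (f.apex ≫ spanLift.π₂ _ _ _))
  klift_unit a X := by
    have h := kleisliExt_unit subGiry X.apex
    refine (eq_comp_gradeCast (g := 𝟙 (spanLift (Δ a) (δ a) X)) _
      (kleisliExt_unit subGiry X.left) (kleisliExt_unit subGiry X.right)
      (congrArg (spanLift.π₁ _ _ _ ≫ ·) h)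
      (congrArg (spanLift.π₂ _ _ _ ≫ ·) h)).trans (Category.id_comp _)
  klift_klift a b c X Y Z f g := by
    refine (eq_comp_gradeCast _ (kleisliExt_comp_kleisliExt subGiry f.left g.left)
      (kleisliExt_comp_kleisliExt subGiry f.right g.right)
      (congrArg (spanLift.π₁ _ _ _ ≫ ·) (kleisliExt_comp_kleisliExt subGiry
        (f.apex ≫ spanLift.π₁ _ _ _) (g.apex ≫ spanLift.π₁ _ _ _)))
      (congrArg (spanLift.π₂ _ _ _ ≫ ·) (kleisliExt_comp_kleisliExt subGiry
        (f.apex ≫ spanLift.π₂ _ _ _) (g.apex ≫ spanLift.π₂ _ _ _)))).trans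
      (Category.assoc _ _ _)
  klift_comp_unit a X Y f := eq_comp_gradeCast _ (kleisliExt_comp_unit subGiry f.left)
    (kleisliExt_comp_unit subGiry f.right)
    (congrArg (spanLift.π₁ _ _ _ ≫ ·) (kleisliExt_comp_unit subGiry f.apex))
    (congrArg (spanLift.π₂ _ _ _ ≫ ·) (kleisliExt_comp_unit subGiry f.apex))

variable [AddLeftMono A] [AddRightMono A]

theorem isGradedLifting (H : IsComposable Δ δ) :
    IsGradedLifting H.gradedMonad SpanMeas.forget subGiryPair where
  obj_eq _ _ := rfl
  map_eq _ _ _ _ := rfl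
  unit_eq _ := rfl
  klift_eq _ _ _ _ _ := rfl
  incl_eq _ _ := rfl

/-- The double strength of the graded monad of approximate span-liftings. -/
def doubleStrength (H : IsComposable Δ δ) : DoubleStrength H.gradedMonad where
  dst a b X Y :=
    { left := subGiryDst X.left Y.left
      right := subGiryDst X.right Y.right
      apex := witnessLift (Φ := X.apex ⊗ Y.apex)
        ((spanLift.π₁ _ _ X ⊗ₘ spanLift.π₁ _ _ Y) ≫ subGiryDst X.apex Y.apex)
        ((spanLift.π₂ _ _ X ⊗ₘ spanLift.π₂ _ _ Y) ≫ subGiryDst X.apex Y.apex)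
        fun p => H.prod p.1.2 p.2.2
      w₁ := congrArg ((spanLift.π₁ _ _ X ⊗ₘ spanLift.π₁ _ _ Y) ≫ ·)
        (subGiryDst_naturality X.ρ₁ Y.ρ₁)
      w₂ := congrArg ((spanLift.π₂ _ _ X ⊗ₘ spanLift.π₂ _ _ Y) ≫ ·)
        (subGiryDst_naturality X.ρ₂ Y.ρ₂) }
  naturality a b X X' Y Y' f g := spanLift_hom_ext
    (subGiryDst_naturality f.left g.left) (subGiryDst_naturality f.right g.right)
    (congrArg ((spanLift.π₁ _ _ X ⊗ₘ spanLift.π₁ _ _ Y) ≫ ·)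
      (subGiryDst_naturality f.apex g.apex))
    (congrArg ((spanLift.π₂ _ _ X ⊗ₘ spanLift.π₂ _ _ Y) ≫ ·)
      (subGiryDst_naturality f.apex g.apex))
  incl h h' X Y := spanLift_hom_ext rfl rfl rfl rfl
  unit X Y := eq_comp_gradeCast _ (subGiryDst_unit X.left Y.left)
    (subGiryDst_unit X.right Y.right) (subGiryDst_unit X.apex Y.apex)
    (subGiryDst_unit X.apex Y.apex)
  klift c d a b X X' Y Y' f g := by
    refine (eq_comp_gradeCast _ (subGiryDst_kleisliExt f.left g.left)
      (subGiryDst_kleisliExt f.right g.right)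
      (congrArg ((spanLift.π₁ _ _ X ⊗ₘ spanLift.π₁ _ _ Y) ≫ ·) (subGiryDst_kleisliExt
        (f.apex ≫ spanLift.π₁ _ _ _) (g.apex ≫ spanLift.π₁ _ _ _)))
      (congrArg ((spanLift.π₂ _ _ X ⊗ₘ spanLift.π₂ _ _ Y) ≫ ·) (subGiryDst_kleisliExt
        (f.apex ≫ spanLift.π₂ _ _ _) (g.apex ≫ spanLift.π₂ _ _ _)))).trans
      (Category.assoc _ _ _)
  associativity a b c X Y Z := by
    -- Reversing and reassociating isolates the identification of grades as the last factor, as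
    -- `eq_comp_gradeCast` requires.
    refine Eq.symm (.trans ?_ (congrArg (_ ≫ ·) (Category.assoc _ _ _)))
    refine .trans ?_ (Category.assoc _ _ _)
    exact eq_comp_gradeCast _
      (subGiryDst_associativity X.left Y.left Z.left).symm
      (subGiryDst_associativity X.right Y.right Z.right).symm
      (congrArg (((spanLift.π₁ _ _ X ⊗ₘ spanLift.π₁ _ _ Y) ⊗ₘ spanLift.π₁ _ _ Z) ≫ ·)
        (subGiryDst_associativity X.apex Y.apex Z.apex).symm)
      (congrArg (((spanLift.π₂ _ _ X ⊗ₘ spanLift.π₂ _ _ Y) ⊗ₘ spanLift.π₂ _ _ Z) ≫ ·)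
        (subGiryDst_associativity X.apex Y.apex Z.apex).symm)
  left_unit a X := eq_comp_gradeCast _
    (subGiryDst_left_unit X.left) (subGiryDst_left_unit X.right)
    -- The left factor is the unit span, whose apex is a point and not a witness space, so the
    -- identity takes the place of a projection.
    (congrArg ((𝟙 (𝟙_ MeasCat.{u}) ⊗ₘ spanLift.π₁ _ _ X) ≫ ·) (subGiryDst_left_unit X.apex))
    (congrArg ((𝟙 (𝟙_ MeasCat.{u}) ⊗ₘ spanLift.π₂ _ _ X) ≫ ·) (subGiryDst_left_unit X.apex))
  right_unit a X := eq_comp_gradeCast _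
    (subGiryDst_right_unit X.left) (subGiryDst_right_unit X.right)
    (congrArg ((spanLift.π₁ _ _ X ⊗ₘ 𝟙 (𝟙_ MeasCat.{u})) ≫ ·) (subGiryDst_right_unit X.apex))
    (congrArg ((spanLift.π₂ _ _ X ⊗ₘ 𝟙 (𝟙_ MeasCat.{u})) ≫ ·) (subGiryDst_right_unit X.apex))
  symmetry a b X Y := by
    refine Eq.symm (.trans ?_ (Category.assoc _ _ _))
    exact eq_comp_gradeCast _
      (subGiryDst_symmetry X.left Y.left).symm (subGiryDst_symmetry X.right Y.right).symm
      (congrArg ((spanLift.π₁ _ _ X ⊗ₘ spanLift.π₁ _ _ Y) ≫ ·)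
        (subGiryDst_symmetry X.apex Y.apex).symm)
      (congrArg ((spanLift.π₂ _ _ X ⊗ₘ spanLift.π₂ _ _ Y) ≫ ·)
        (subGiryDst_symmetry X.apex Y.apex).symm)

theorem isGradedLiftingWithDoubleStrength (H : IsComposable Δ δ) :
    IsGradedLiftingWithDoubleStrength Δ δ :=
  ⟨H.gradedMonad, H.doubleStrength, H.isGradedLifting,
    { tensor_eq := fun _ _ => rfl
      dst_eq := fun _ _ _ _ => rfl },
    { map := fun _ _ _ _ _ => rfl
      unit := fun _ _ => rfl
      klift := fun _ _ _ _ _ _ => rfl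
      incl := fun _ _ _ => rfl
      dst := fun _ _ _ _ _ _ => rfl }⟩

end IsComposable

end Composable


/-! ### Densities with respect to the sum -/

section Density

variable {X : Type u} [MeasurableSpace X]

/-- The `ℝ≥0`-valued density of `μ` with respect to `μ + ν`. -/
def density₁ (μ ν : SubProb X) (x : X) : ℝ≥0 := (μ.1.rnDeriv (μ.1 + ν.1) x).toNNReal

/-- The `ℝ≥0`-valued density of `ν` with respect to `μ + ν`. -/
def density₂ (μ ν : SubProb X) (x : X) : ℝ≥0 := (ν.1.rnDeriv (μ.1 + ν.1) x).toNNReal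

theorem measurable_density₁ (μ ν : SubProb X) : Measurable (density₁ μ ν) :=
  (Measure.measurable_rnDeriv _ _).ennreal_toNNReal

theorem measurable_density₂ (μ ν : SubProb X) : Measurable (density₂ μ ν) :=
  (Measure.measurable_rnDeriv _ _).ennreal_toNNReal

/-- Since `μ ≪ μ + ν`, the derivative recovers `μ`; it is finite almost everywhere, so nothing is
lost by taking it in `ℝ≥0`. -/
theorem lintegral_density₁ (μ ν : SubProb X) {g : X → ℝ≥0∞} (hg : Measurable g) :
    ∫⁻ x, density₁ μ ν x * g x ∂(μ.1 + ν.1) = ∫⁻ x, g x ∂μ.1 := by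
  have hac : μ.1 ≪ μ.1 + ν.1 := Measure.AbsolutelyContinuous.rfl.add_right _
  rw [← lintegral_rnDeriv_mul hac hg.aemeasurable]
  refine lintegral_congr_ae ?_
  filter_upwards [Measure.rnDeriv_lt_top μ.1 (μ.1 + ν.1)] with x hx
  rw [density₁, ENNReal.coe_toNNReal hx.ne]

theorem lintegral_density₂ (μ ν : SubProb X) {g : X → ℝ≥0∞} (hg : Measurable g) :
    ∫⁻ x, density₂ μ ν x * g x ∂(μ.1 + ν.1) = ∫⁻ x, g x ∂ν.1 := by
  have hac : ν.1 ≪ μ.1 + ν.1 :=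
    Measure.absolutelyContinuous_of_le (Measure.le_add_left le_rfl)
  rw [← lintegral_rnDeriv_mul hac hg.aemeasurable]
  refine lintegral_congr_ae ?_
  filter_upwards [Measure.rnDeriv_lt_top ν.1 (μ.1 + ν.1)] with x hx
  rw [density₂, ENNReal.coe_toNNReal hx.ne]

end Density

theorem measurable_lintegral_apply {X Y : MeasCat.{u}} (f : X ⟶ subGiry.obj Y) {g : Y → ℝ≥0∞}
    (hg : Measurable g) : Measurable fun x => ∫⁻ y, g y ∂(f.1 x).1 :=
  ((Measure.measurable_lintegral hg).comp measurable_subtype_coe).comp f.2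

theorem lintegral_kleisliExt {X Y : MeasCat.{u}} (f : X ⟶ subGiry.obj Y) (μ : SubProb X)
    {g : Y → ℝ≥0∞} (hg : Measurable g) :
    ∫⁻ y, g y ∂((kleisliExt subGiry f).1 μ).1 = ∫⁻ x, ∫⁻ y, g y ∂(f.1 x).1 ∂μ.1 :=
  (SubProb.lintegral_join _ hg).trans
    (lintegral_map ((Measure.measurable_lintegral hg).comp measurable_subtype_coe) f.2)

/-! ### Differential privacy -/

/-- The integral form of the divergence for differential privacy. -/
def hockeyStick {X : Type u} [MeasurableSpace X] (e : ℝ≥0) (μ ν : SubProb X) : ℝ≥0∞ :=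
  ∫⁻ x, ((density₂ μ ν x : ℝ≥0∞) - e * density₁ μ ν x) ∂(μ.1 + ν.1)

/-- For `t ≠ 0` the expression `t * f (a / t)` is the truncated difference `t - e * a`, which is
continuous at `t = 0` with value `0`; the boundary convention thus gives the same formula. -/
theorem perspective_hockeyStick (e a b : ℝ≥0) :
    perspective (fun t => (1 - e * t : ℝ).toNNReal) a b = b - e * a := by
  have key (t : ℝ≥0) (ht : t ≠ 0) : t * (1 - e * (a / t : ℝ≥0) : ℝ).toNNReal = t - e * a := by
    have h0 : (t : ℝ) ≠ 0 := by exact_mod_cast ht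
    have hm (y : ℝ) : t * y.toNNReal = (t * y).toNNReal := by
      rw [Real.toNNReal_mul t.coe_nonneg, Real.toNNReal_coe]
    rw [NNReal.sub_def, hm]
    congr 1
    push_cast
    field_simp
  unfold perspective
  split_ifs with hb ha
  · rw [key b hb]; push_cast; rfl
  · simp [ha, not_not.1 hb]
  · rw [not_not.1 hb]
    have h0 : ∀ᶠ t : ℝ≥0 in 𝓝[>] 0,
        (fun t : ℝ≥0 => ((t * (1 - e * (a / t : ℝ≥0) : ℝ).toNNReal : ℝ≥0) : ℝ≥0∞)) t =
          (fun t : ℝ≥0 => ((t - e * a : ℝ≥0) : ℝ≥0∞)) t := by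
      filter_upwards [self_mem_nhdsWithin] with t ht
      have := key t (ne_of_gt ht)
      simp only [this]
    rw [Filter.limsup_congr h0]
    refine Filter.Tendsto.limsup_eq ?_
    have : Filter.Tendsto (fun t : ℝ≥0 => ((t - e * a : ℝ≥0) : ℝ≥0∞)) (𝓝 0)
        (𝓝 ((0 - e * a : ℝ≥0) : ℝ≥0∞)) := by
      refine Continuous.tendsto ?_ 0
      fun_prop
    simpa using this.mono_left nhdsWithin_le_nhds

theorem dpDivergence_eq (ε : ℝ≥0) {X : MeasCat.{u}} (μ ν : SubProb X) :
    dpDivergence ε X μ ν = (hockeyStick (Real.exp ε).toNNReal μ ν : EReal) := by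
  unfold dpDivergence fDivergence hockeyStick
  congr 1
  refine lintegral_congr fun x => ?_
  have := perspective_hockeyStick (Real.exp ε).toNNReal (density₁ μ ν x) (density₂ μ ν x)
  rw [Real.coe_toNNReal _ (Real.exp_pos _).le] at this
  exact this

/-- With densities `p`, `q` one has `q ≤ e p + (q - e p)` in truncated subtraction; multiply by `g`
and use `g ≤ 1` on the excess only. -/
theorem lintegral_le_of_hockeyStick {X : Type u} [MeasurableSpace X] {e : ℝ≥0} {δ : ℝ≥0∞}
    {μ ν : SubProb X} (h : hockeyStick e μ ν ≤ δ) {g : X → ℝ≥0∞} (hg : Measurable g)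
    (hg1 : ∀ x, g x ≤ 1) : ∫⁻ x, g x ∂ν.1 ≤ e * ∫⁻ x, g x ∂μ.1 + δ := by
  have h₁ := measurable_density₁ μ ν
  have h₂ := measurable_density₂ μ ν
  rw [← lintegral_density₁ μ ν hg, ← lintegral_density₂ μ ν hg,
    ← lintegral_const_mul _ (by fun_prop)]
  refine le_trans ?_ (add_le_add_right h _)
  rw [hockeyStick, ← lintegral_add_left (by fun_prop)]
  refine lintegral_mono fun x => ?_
  calc (density₂ μ ν x : ℝ≥0∞) * g x
      ≤ (e * density₁ μ ν x + (density₂ μ ν x - e * density₁ μ ν x)) * g x := by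
        gcongr; exact le_add_tsub
    _ = e * (density₁ μ ν x * g x) + (density₂ μ ν x - e * density₁ μ ν x) * g x := by ring
    _ ≤ _ := by gcongr; exact mul_le_of_le_one_right' (hg1 x)

/-- The set where `e p ≤ q` captures the whole excess, so testing on that set alone gives the
divergence exactly. -/
theorem hockeyStick_le {X : Type u} [MeasurableSpace X] {e : ℝ≥0} {δ : ℝ≥0∞} {μ ν : SubProb X}
    (h : ∀ S, MeasurableSet S → ν.1 S ≤ e * μ.1 S + δ) : hockeyStick e μ ν ≤ δ := by
  have h₁ := measurable_density₁ μ ν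
  have h₂ := measurable_density₂ μ ν
  set S : Set X := {x | (e * density₁ μ ν x : ℝ≥0∞) ≤ density₂ μ ν x} with hSdef
  have hS : MeasurableSet S := measurableSet_le (by fun_prop) (by fun_prop)
  have hi : Measurable (S.indicator (1 : X → ℝ≥0∞)) := measurable_one.indicator hS
  have hμ : μ.1 S = ∫⁻ x, density₁ μ ν x * S.indicator 1 x ∂(μ.1 + ν.1) := by
    rw [lintegral_density₁ μ ν hi, lintegral_indicator_one hS]
  have hν : ν.1 S = ∫⁻ x, density₂ μ ν x * S.indicator 1 x ∂(μ.1 + ν.1) := by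
    rw [lintegral_density₂ μ ν hi, lintegral_indicator_one hS]
  have key : e * μ.1 S + hockeyStick e μ ν = ν.1 S := by
    rw [hμ, hν, hockeyStick, ← lintegral_const_mul _ (by fun_prop),
      ← lintegral_add_left (by fun_prop)]
    refine lintegral_congr fun x => ?_
    by_cases hx : x ∈ S
    · have : (e * density₁ μ ν x : ℝ≥0∞) ≤ density₂ μ ν x := hx
      simp [hx, add_tsub_cancel_of_le this]
    · have : (density₂ μ ν x : ℝ≥0∞) ≤ e * density₁ μ ν x := (not_le.1 hx).le
      simp [hx, tsub_eq_zero_of_le this]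
  refine ENNReal.le_of_add_le_add_left (a := e * μ.1 S)
    (ENNReal.mul_ne_top ENNReal.coe_ne_top (measure_ne_top μ.1 S)) ?_
  rw [key]
  exact h S hS

theorem hockeyStick_kleisliExt_le {X Y : MeasCat.{u}} {e e' : ℝ≥0} {δ δ' : ℝ≥0∞}
    (f g : X ⟶ subGiry.obj Y) {μ ν : SubProb X} (h : hockeyStick e μ ν ≤ δ)
    (h' : ∀ x, hockeyStick (X := Y) e' (f.1 x) (g.1 x) ≤ δ') :
    hockeyStick (X := Y) (e * e') ((kleisliExt subGiry f).1 μ) ((kleisliExt subGiry g).1 ν) ≤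
      δ + δ' := by
  refine hockeyStick_le fun S hS => ?_
  have hf : Measurable fun x => (f.1 x).1 S := (SubProb.measurable_eval hS).comp f.2
  -- Truncation at `1` makes `k` an admissible test function for the outer bound. It costs nothing,
  -- because `(g x) S ≤ 1` already.
  set k : X → ℝ≥0∞ := fun x => min 1 (e' * (f.1 x).1 S) with hk
  have hkm : Measurable k := measurable_const.min (hf.const_mul _)
  have hpt (x : X) : (g.1 x).1 S ≤ k x + δ' := by
    have le_one (τ : SubProb Y) : τ.1 S ≤ 1 := (measure_mono (Set.subset_univ S)).trans τ.2
    have apply_le (σ τ : SubProb Y) (hστ : hockeyStick e' σ τ ≤ δ') :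
        τ.1 S ≤ e' * σ.1 S + δ' := by
      simpa [lintegral_indicator_one hS] using lintegral_le_of_hockeyStick hστ
        (measurable_one.indicator hS) (Set.indicator_le_self' (by simp))
    rw [hk, min_add]
    exact le_min ((le_one _).trans le_self_add) (apply_le _ _ (h' x))
  refine (subGiry_kleisliExt_apply g ν hS).trans_le ?_
  have hμ := subGiry_kleisliExt_apply f μ hS
  rw [hμ]
  calc ∫⁻ x, (g.1 x).1 S ∂ν.1 ≤ ∫⁻ x, (k x + δ') ∂ν.1 := lintegral_mono hpt
    _ = ∫⁻ x, k x ∂ν.1 + δ' * ν.1 Set.univ := by rw [lintegral_add_left hkm, lintegral_const]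
    _ ≤ (e * ∫⁻ x, k x ∂μ.1 + δ) + δ' := by
        gcongr
        · exact lintegral_le_of_hockeyStick h hkm fun x => min_le_left _ _
        -- The inner error `δ'` is averaged against a measure of mass at most `1`, and so it is
        -- added without a factor.
        · exact mul_le_of_le_one_right' ν.2
    _ ≤ (e * ∫⁻ x, e' * (f.1 x).1 S ∂μ.1 + δ) + δ' := by
        gcongr with x
        exact min_le_right _ _
    _ = _ := by rw [lintegral_const_mul _ hf]; push_cast; ring

theorem dpDivergence_le_iff {ε δ : ℝ≥0} {X : MeasCat.{u}} {μ ν : SubProb X} :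
    dpDivergence ε X μ ν ≤ ((δ : ℝ) : EReal) ↔ hockeyStick (Real.exp ε).toNNReal μ ν ≤ δ := by
  rw [dpDivergence_eq]
  exact EReal.coe_ennreal_le_coe_ennreal_iff (y := (δ : ℝ≥0∞))

theorem isComposable_dpDivergence : IsComposable.{u} (A := ℝ≥0 × ℝ≥0)
    (fun a => dpDivergence a.1) (fun a => ((a.2 : ℝ) : EReal)) where
  refl x := by
    refine dpDivergence_le_iff.2 (hockeyStick_le fun S hS => ?_)
    simp
  mono {a b} hab X μ ν h := by
    refine dpDivergence_le_iff.2 (hockeyStick_le fun S hS => ?_)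
    -- In the form `ν S ≤ e^ε * μ S + δ`, the bound is visibly monotone in both `ε` and `δ`.
    have := lintegral_le_of_hockeyStick (dpDivergence_le_iff.1 h) (measurable_one.indicator hS)
      (Set.indicator_le_self' (by simp))
    simp only [lintegral_indicator_one hS] at this
    refine this.trans ?_
    have h1 : a.1 ≤ b.1 := hab.1
    have h2 : a.2 ≤ b.2 := hab.2
    gcongr
  comp {a b X Y} f g μ ν h h' := by
    refine dpDivergence_le_iff.2 ?_
    have := hockeyStick_kleisliExt_le f g (dpDivergence_le_iff.1 h)
      fun x => dpDivergence_le_iff.1 (h' x)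
    rw [← Real.toNNReal_mul (Real.exp_pos _).le, ← Real.exp_add] at this
    exact_mod_cast this


/-! ### Rényi divergences -/

/-- The integral `∫ (p / q) ^ β * p`, where `p` and `q` are the densities of `μ` and `ν`. -/
def renyiIntegral {X : Type u} [MeasurableSpace X] (β : ℝ) (μ ν : SubProb X) : ℝ≥0∞ :=
  ∫⁻ x, ((density₁ μ ν x : ℝ≥0∞) / density₂ μ ν x) ^ β * density₁ μ ν x ∂(μ.1 + ν.1)

/-- The identity `b (a/b)^α = (a/b)^(α-1) a` moves the degenerate case into `ℝ≥0∞`, where `a / 0 =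
∞` for `a > 0` agrees with the limit convention by continuity of division and powers. -/
theorem perspective_rpow {α : ℝ} (hα : 1 < α) (a b : ℝ≥0) :
    perspective (fun t => t ^ α) a b = ((a : ℝ≥0∞) / b) ^ (α - 1) * a := by
  have hβ : 0 < α - 1 := sub_pos.2 hα
  have key (t : ℝ≥0) (ht : t ≠ 0) :
      ((t * (a / t) ^ α : ℝ≥0) : ℝ≥0∞) = ((a : ℝ≥0∞) / t) ^ (α - 1) * a := by
    rw [← ENNReal.coe_div ht, ← ENNReal.coe_rpow_of_nonneg _ hβ.le, ← ENNReal.coe_mul]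
    congr 1
    have hα0 : α - 1 + 1 ≠ 0 := by rw [sub_add_cancel]; exact (zero_lt_one.trans hα).ne'
    calc t * (a / t) ^ α = t * ((a / t) ^ (α - 1) * (a / t)) := by
          rw [← NNReal.rpow_add_one' hα0, sub_add_cancel]
      _ = (a / t) ^ (α - 1) * (a / t * t) := by ring
      _ = _ := by rw [div_mul_cancel₀ _ ht]
  unfold perspective
  split_ifs with hb ha
  · exact key b hb
  · simp [ha]
  · rw [not_not.1 hb]
    have h0 : ∀ᶠ t : ℝ≥0 in 𝓝[>] 0,
        (fun t : ℝ≥0 => ((t * (a / t) ^ α : ℝ≥0) : ℝ≥0∞)) t =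
          (fun t : ℝ≥0 => ((a : ℝ≥0∞) / t) ^ (α - 1) * a) t := by
      filter_upwards [self_mem_nhdsWithin] with t ht
      exact key t (ne_of_gt ht)
    rw [Filter.limsup_congr h0]
    have : Filter.Tendsto (fun t : ℝ≥0 => ((a : ℝ≥0∞) / t) ^ (α - 1) * a) (𝓝 0)
        (𝓝 (((a : ℝ≥0∞) / (0 : ℝ≥0)) ^ (α - 1) * a)) := by
      refine ENNReal.Tendsto.mul_const ?_ (.inr ENNReal.coe_ne_top)
      refine (ENNReal.continuous_rpow_const.tendsto _).comp ?_
      refine ENNReal.Tendsto.const_div ?_ (.inr ENNReal.coe_ne_top)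
      exact ENNReal.continuous_coe.tendsto _
    exact (this.mono_left nhdsWithin_le_nhds).limsup_eq

theorem fDivergence_rpow {α : ℝ} (hα : 1 < α) {X : MeasCat.{u}} (μ ν : SubProb X) :
    fDivergence (fun t => t ^ α) μ ν = renyiIntegral (α - 1) μ ν :=
  lintegral_congr fun _ => perspective_rpow hα _ _

/-- Young's inequality in perspective form. -/
theorem young_perspective {β : ℝ} (hβ : 0 < β) (t a b : ℝ≥0) :
    ENNReal.ofReal (1 + β) * (t : ℝ≥0∞) ^ β * a ≤
      ENNReal.ofReal β * (t : ℝ≥0∞) ^ (1 + β) * b + ((a : ℝ≥0∞) / b) ^ β * a := by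
  rcases eq_or_ne b 0 with rfl | hb
  · rcases eq_or_ne a 0 with rfl | ha
    · simp
    · simp [ENNReal.div_zero, ha, hβ]
  have h0 : (b : ℝ≥0∞) ≠ 0 := by exact_mod_cast hb
  set y : ℝ≥0∞ := (a : ℝ≥0∞) / b with hy
  have hay : (a : ℝ≥0∞) = y * b := (ENNReal.div_mul_cancel h0 ENNReal.coe_ne_top).symm
  have hα : 0 < 1 + β := by linarith
  -- Young's inequality is applied to `y = a / b` and `t ^ β`; the second conjugate power is `t ^ (1
  -- + β)`. Multiplying by `(1 + β) * b` clears the denominators.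
  have hpq : (1 + β).HolderConjugate ((1 + β) / β) := by
    rw [Real.holderConjugate_iff]
    refine ⟨by linarith, ?_⟩
    field_simp
  have hyoung := ENNReal.young_inequality y ((t : ℝ≥0∞) ^ β) hpq
  rw [← ENNReal.rpow_mul, mul_div_cancel₀ _ hβ.ne', ENNReal.ofReal_div_of_pos hβ] at hyoung
  have hA : ENNReal.ofReal (1 + β) ≠ 0 := by simpa using hα
  have hB : ENNReal.ofReal β ≠ 0 := by simpa using hβ
  have key : ENNReal.ofReal (1 + β) * (t : ℝ≥0∞) ^ β * y ≤
      ENNReal.ofReal β * (t : ℝ≥0∞) ^ (1 + β) + y ^ (1 + β) := by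
    calc ENNReal.ofReal (1 + β) * (t : ℝ≥0∞) ^ β * y
        = ENNReal.ofReal (1 + β) * (y * (t : ℝ≥0∞) ^ β) := by ring
      _ ≤ ENNReal.ofReal (1 + β) * _ := mul_le_mul_right hyoung _
      _ = _ := by
        rw [mul_add, ENNReal.mul_div_cancel hA ENNReal.ofReal_ne_top, add_comm]
        congr 1
        rw [div_eq_mul_inv, ENNReal.inv_div (.inl ENNReal.ofReal_ne_top) (.inl hB),
          mul_comm (_ ^ _), ← mul_assoc, ENNReal.mul_div_cancel hA ENNReal.ofReal_ne_top]
  calc ENNReal.ofReal (1 + β) * (t : ℝ≥0∞) ^ β * a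
      = ENNReal.ofReal (1 + β) * (t : ℝ≥0∞) ^ β * y * b := by rw [hay]; ring
    _ ≤ (ENNReal.ofReal β * (t : ℝ≥0∞) ^ (1 + β) + y ^ (1 + β)) * b := by gcongr
    _ = _ := by
      rw [add_mul, hay, ENNReal.rpow_add_of_nonneg _ _ zero_le_one hβ.le (x := y),
        ENNReal.rpow_one]
      ring

theorem young_renyiIntegral {X : Type u} [MeasurableSpace X] {β : ℝ} (hβ : 0 < β)
    (μ ν : SubProb X) {t : X → ℝ≥0} (ht : Measurable t) :
    ENNReal.ofReal (1 + β) * ∫⁻ x, (t x : ℝ≥0∞) ^ β ∂μ.1 ≤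
      ENNReal.ofReal β * ∫⁻ x, (t x : ℝ≥0∞) ^ (1 + β) ∂ν.1 + renyiIntegral β μ ν := by
  have h₁ := measurable_density₁ μ ν
  have h₂ := measurable_density₂ μ ν
  rw [← lintegral_density₁ μ ν (by fun_prop), ← lintegral_density₂ μ ν (by fun_prop),
    ← lintegral_const_mul _ (by fun_prop), ← lintegral_const_mul _ (by fun_prop), renyiIntegral,
    ← lintegral_add_left (by fun_prop)]
  refine lintegral_mono fun x => ?_
  refine le_trans (le_of_eq ?_) ((young_perspective hβ (t x) (density₁ μ ν x)
    (density₂ μ ν x)).trans (le_of_eq ?_)) <;> ring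

/-- The variational characterization of the Rényi integral. -/
theorem renyiIntegral_le {X : Type u} [MeasurableSpace X] {β : ℝ} (hβ : 0 < β) {μ ν : SubProb X}
    {C : ℝ≥0∞} (h : ∀ t : X → ℝ≥0, Measurable t → (∃ n : ℝ≥0, ∀ x, t x ≤ n) →
      ENNReal.ofReal (1 + β) * ∫⁻ x, (t x : ℝ≥0∞) ^ β ∂μ.1 ≤
        ENNReal.ofReal β * ∫⁻ x, (t x : ℝ≥0∞) ^ (1 + β) ∂ν.1 + C) :
    renyiIntegral β μ ν ≤ C := by
  have h₁ := measurable_density₁ μ ν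
  have h₂ := measurable_density₂ μ ν
  set y : X → ℝ≥0∞ := fun x => (density₁ μ ν x : ℝ≥0∞) / density₂ μ ν x with hy
  have hym : Measurable y := by fun_prop
  -- Young's inequality is an equality at `t = p / q`. The truncations at `n` keep the test bounded,
  -- so that the `ν`-term is finite and can be cancelled.
  set t : ℕ → X → ℝ≥0 := fun n x => (min (y x) n).toNNReal with ht
  have htm (n : ℕ) : Measurable (t n) := (hym.min measurable_const).ennreal_toNNReal
  have htc (n : ℕ) (x : X) : (t n x : ℝ≥0∞) = min (y x) n :=
    ENNReal.coe_toNNReal ((min_le_right _ _).trans_lt (ENNReal.natCast_lt_top n)).ne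
  have htb (n : ℕ) (x : X) : t n x ≤ n := by
    have := (htc n x).trans_le (min_le_right _ _)
    exact_mod_cast this
  have hbound (n : ℕ) : ∫⁻ x, density₁ μ ν x * (t n x : ℝ≥0∞) ^ β ∂(μ.1 + ν.1) ≤ C := by
    have hfin : ENNReal.ofReal β * ∫⁻ x, (t n x : ℝ≥0∞) ^ (1 + β) ∂ν.1 ≠ ⊤ := by
      refine ENNReal.mul_ne_top ENNReal.ofReal_ne_top (ne_top_of_le_ne_top ?_
        (lintegral_mono (g := fun _ => ((n : ℝ≥0) : ℝ≥0∞) ^ (1 + β)) fun x => ?_))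
      · rw [lintegral_const]
        exact ENNReal.mul_ne_top (ENNReal.rpow_ne_top_of_nonneg (by linarith) ENNReal.coe_ne_top)
          (measure_ne_top ν.1 _)
      · exact ENNReal.rpow_le_rpow (by exact_mod_cast htb n x) (by linarith)
    refine ENNReal.le_of_add_le_add_left hfin (le_trans ?_ (h (t n) (htm n) ⟨n, htb n⟩))
    have := htm n
    rw [← lintegral_density₁ μ ν (by fun_prop), ← lintegral_density₂ μ ν (by fun_prop),
      ← lintegral_const_mul _ (by fun_prop), ← lintegral_const_mul _ (by fun_prop),
      ← lintegral_add_left (by fun_prop)]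
    refine lintegral_mono fun x => ?_
    -- From `q t ≤ p` follows `q t^(1+β) ≤ p t^β`, which leaves at least one copy of `p t^β` out of
    -- the `1 + β` on the left of the hypothesis.
    have hle : (density₂ μ ν x : ℝ≥0∞) * t n x ≤ density₁ μ ν x := by
      rw [htc]
      exact (mul_le_mul_right (min_le_left _ _) _).trans ENNReal.mul_div_le
    calc ENNReal.ofReal β * (density₂ μ ν x * (t n x : ℝ≥0∞) ^ (1 + β)) +
          density₁ μ ν x * (t n x : ℝ≥0∞) ^ β
        = ENNReal.ofReal β * ((density₂ μ ν x * t n x) * (t n x : ℝ≥0∞) ^ β) +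
          density₁ μ ν x * (t n x : ℝ≥0∞) ^ β := by
          rw [ENNReal.rpow_add_of_nonneg _ _ zero_le_one hβ.le, ENNReal.rpow_one]; ring
      _ ≤ ENNReal.ofReal β * (density₁ μ ν x * (t n x : ℝ≥0∞) ^ β) +
          density₁ μ ν x * (t n x : ℝ≥0∞) ^ β := by gcongr
      _ = _ := by rw [ENNReal.ofReal_add zero_le_one hβ.le, ENNReal.ofReal_one]; ring
  have hlim : Filter.Tendsto
      (fun n => ∫⁻ x, density₁ μ ν x * (t n x : ℝ≥0∞) ^ β ∂(μ.1 + ν.1)) Filter.atTop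
      (𝓝 (∫⁻ x, density₁ μ ν x * y x ^ β ∂(μ.1 + ν.1))) := by
    refine lintegral_tendsto_of_tendsto_of_monotone (fun n => ?_) (.of_forall fun x => ?_)
      (.of_forall fun x => ?_)
    · have := htm n
      fun_prop
    · intro m n hmn
      simp only [htc]
      gcongr
    · refine ENNReal.Tendsto.const_mul ?_ (.inr ENNReal.coe_ne_top)
      refine (ENNReal.continuous_rpow_const.tendsto _).comp ?_
      simp only [htc]
      simpa using (tendsto_const_nhds (x := y x)).min ENNReal.tendsto_nat_nhds_top
  refine le_trans (le_of_eq ?_) (le_of_tendsto' hlim hbound)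
  exact lintegral_congr fun x => mul_comm _ _

/-- The pointwise inequality behind the composability of the Rényi integral. -/
theorem mul_le_of_forall_rpow_le {β : ℝ} (hβ : 0 < β) {A B K : ℝ≥0∞} (hB : B ≠ ⊤)
    (h : ∀ s : ℝ≥0, (s : ℝ≥0∞) ^ β * A ≤ (s : ℝ≥0∞) ^ (1 + β) * B + K) (p q : ℝ≥0) :
    p * A ≤ q * B + K * (((p : ℝ≥0∞) / q) ^ β * p) := by
  rcases eq_or_ne p 0 with rfl | hp
  · simp
  have hp0 : (p : ℝ≥0∞) ≠ 0 := by exact_mod_cast hp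
  rcases eq_or_ne q 0 with rfl | hq
  -- At `q = 0` the right side is infinite unless `K = 0`. In that case dividing the hypothesis by
  -- `s ^ β` gives `A ≤ s * B`, and `s → 0` forces `A = 0` because `B` is finite.
  · rcases eq_or_ne K 0 with rfl | hK
    · have hA : A ≤ 0 := by
        have hlim : Filter.Tendsto (fun s : ℝ≥0 => (s : ℝ≥0∞) * B) (𝓝[>] 0) (𝓝 0) := by
          have : Filter.Tendsto (fun s : ℝ≥0 => (s : ℝ≥0∞) * B) (𝓝 0)
              (𝓝 (((0 : ℝ≥0) : ℝ≥0∞) * B)) :=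
            ENNReal.Tendsto.mul_const (ENNReal.continuous_coe.tendsto _) (.inr hB)
          simpa using this.mono_left nhdsWithin_le_nhds
        refine ge_of_tendsto hlim ?_
        filter_upwards [self_mem_nhdsWithin] with s hs
        have hs0 : (s : ℝ≥0∞) ≠ 0 := by exact_mod_cast (ne_of_gt hs : s ≠ 0)
        have := h s
        rw [add_zero, add_comm, ENNReal.rpow_add_of_nonneg _ _ hβ.le zero_le_one,
          ENNReal.rpow_one, mul_assoc] at this
        exact (ENNReal.mul_le_mul_iff_right (by simp [hs0])
          (ENNReal.rpow_ne_top_of_nonneg hβ.le ENNReal.coe_ne_top)).1 this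
      simp [nonpos_iff_eq_zero.1 hA]
    · simp [ENNReal.div_zero, hp0, hK, hβ]
  have hq0 : (q : ℝ≥0∞) ≠ 0 := by exact_mod_cast hq
  set y : ℝ≥0∞ := (p : ℝ≥0∞) / q with hy
  have hs : ((q / p : ℝ≥0) : ℝ≥0∞) = y⁻¹ := by
    rw [ENNReal.coe_div hp, hy, ENNReal.inv_div (.inl ENNReal.coe_ne_top) (.inl hq0)]
  have hy0 : y ≠ 0 := ENNReal.div_ne_zero.2 ⟨hp0, ENNReal.coe_ne_top⟩
  have hyt : y ≠ ⊤ := ENNReal.div_ne_top ENNReal.coe_ne_top hq0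
  have hyβ : y ^ β * y⁻¹ ^ β = 1 := by
    rw [← ENNReal.mul_rpow_of_nonneg _ _ hβ.le, ENNReal.mul_inv_cancel hy0 hyt, ENNReal.one_rpow]
  have hpy : (p : ℝ≥0∞) * y⁻¹ = q := by
    rw [hy, ENNReal.inv_div (.inl ENNReal.coe_ne_top) (.inl hq0),
      ENNReal.mul_div_cancel hp0 ENNReal.coe_ne_top]
  -- This scale balances the terms: multiplied by `p * (p / q) ^ β`, the coefficient of `A` becomes
  -- `p` and that of `B` becomes `q`.
  have := h (q / p)
  rw [hs] at this
  calc (p : ℝ≥0∞) * A = p * (y ^ β * y⁻¹ ^ β) * A := by rw [hyβ, mul_one]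
    _ = p * y ^ β * (y⁻¹ ^ β * A) := by ring
    _ ≤ p * y ^ β * (y⁻¹ ^ (1 + β) * B + K) := by gcongr
    _ = p * y⁻¹ * (y ^ β * y⁻¹ ^ β) * B + K * (y ^ β * p) := by
      rw [ENNReal.rpow_add_of_nonneg _ _ zero_le_one hβ.le, ENNReal.rpow_one]; ring
    _ = _ := by rw [hyβ, hpy, mul_one]

/-- For a bounded test `t` on `Y`, Young's inequality at a fixed `x` may be applied to every
multiple `s * t`. Choosing `s` from the densities at `x` replaces the constant `K` by `K` times the
integrand of the outer Rényi integral; integrating in `x` gives the product. -/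
theorem renyiIntegral_kleisliExt_le {X Y : MeasCat.{u}} {β : ℝ} (hβ : 0 < β) {K : ℝ≥0∞}
    (f g : X ⟶ subGiry.obj Y) (μ ν : SubProb X)
    (h : ∀ x, renyiIntegral (X := Y) β (f.1 x) (g.1 x) ≤ K) :
    renyiIntegral (X := Y) β ((kleisliExt subGiry f).1 μ) ((kleisliExt subGiry g).1 ν) ≤
      renyiIntegral β μ ν * K := by
  have h₁ := measurable_density₁ μ ν
  have h₂ := measurable_density₂ μ ν
  refine renyiIntegral_le hβ fun t ht ⟨n, hn⟩ => ?_
  have htβ : Measurable fun y => (t y : ℝ≥0∞) ^ β := by fun_prop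
  have htα : Measurable fun y => (t y : ℝ≥0∞) ^ (1 + β) := by fun_prop
  have hf := measurable_lintegral_apply f htβ
  have hg := measurable_lintegral_apply g htα
  refine ((congrArg _ (lintegral_kleisliExt f μ htβ)).trans_le ?_).trans_eq
    (congrArg (fun z => _ * z + _) (lintegral_kleisliExt g ν htα).symm)
  rw [← lintegral_density₁ μ ν hf, ← lintegral_density₂ μ ν hg,
    ← lintegral_const_mul _ (by fun_prop), ← lintegral_const_mul _ (by fun_prop), renyiIntegral,
    ← lintegral_mul_const _ (by fun_prop), ← lintegral_add_left (by fun_prop)]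
  refine lintegral_mono fun x => ?_
  have hfin (τ : SubProb Y) : ∫⁻ y, (t y : ℝ≥0∞) ^ (1 + β) ∂τ.1 ≠ ⊤ := by
    refine ne_top_of_le_ne_top ?_
      (lintegral_mono (g := fun _ => (n : ℝ≥0∞) ^ (1 + β)) fun y => ?_)
    · rw [lintegral_const]
      exact ENNReal.mul_ne_top (ENNReal.rpow_ne_top_of_nonneg (by linarith) ENNReal.coe_ne_top)
        (measure_ne_top τ.1 _)
    · exact ENNReal.rpow_le_rpow (by exact_mod_cast hn y) (by linarith)
  have hyoung (σ τ : SubProb Y) (hK : renyiIntegral β σ τ ≤ K) (s : ℝ≥0) :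
      (s : ℝ≥0∞) ^ β * (ENNReal.ofReal (1 + β) * ∫⁻ y, (t y : ℝ≥0∞) ^ β ∂σ.1) ≤
        (s : ℝ≥0∞) ^ (1 + β) * (ENNReal.ofReal β * ∫⁻ y, (t y : ℝ≥0∞) ^ (1 + β) ∂τ.1) + K := by
    have := (young_renyiIntegral hβ σ τ (ht.const_mul s)).trans (add_le_add_right hK _)
    simp only [ENNReal.coe_mul, ENNReal.mul_rpow_of_nonneg _ _ hβ.le,
      ENNReal.mul_rpow_of_nonneg _ _ (show 0 ≤ 1 + β by linarith)] at this
    rw [lintegral_const_mul _ htβ, lintegral_const_mul _ htα] at this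
    refine le_trans (le_of_eq ?_) (this.trans (le_of_eq ?_)) <;> ring
  refine le_trans (le_of_eq ?_) ((mul_le_of_forall_rpow_le hβ
    (ENNReal.mul_ne_top ENNReal.ofReal_ne_top (hfin _)) (hyoung _ _ (h x))
    (density₁ μ ν x) (density₂ μ ν x)).trans (le_of_eq ?_)) <;> ring

/-- The ratio of equal densities is at most `1`, also for `0 / 0`, so the integral is at most the
total mass. -/
theorem renyiIntegral_self_le {X : Type u} [MeasurableSpace X] {β : ℝ} (hβ : 0 < β)
    (μ : SubProb X) : renyiIntegral β μ μ ≤ 1 := by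
  rw [renyiIntegral]
  have h₁ := measurable_density₁ μ μ
  have : ∫⁻ x, (density₁ μ μ x : ℝ≥0∞) * 1 ∂(μ.1 + μ.1) ≤ 1 := by
    rw [lintegral_density₁ μ μ measurable_const, lintegral_const, one_mul]
    exact μ.2
  refine le_trans (lintegral_mono fun x => ?_) this
  rw [mul_comm]
  gcongr
  exact ENNReal.rpow_le_one ENNReal.div_self_le_one hβ.le

/-! ### From Rényi integrals to Rényi divergences -/

theorem renyiDivergence_le_iff {α : ℝ} (hα : 1 < α) {X : MeasCat.{u}} {μ ν : SubProb X}
    {ρ : EReal} : renyiDivergence α X μ ν ≤ ρ ↔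
      renyiIntegral (α - 1) μ ν ≤ EReal.exp (((α - 1 : ℝ) : EReal) * ρ) := by
  have hβ : 0 < α - 1 := sub_pos.2 hα
  rw [renyiDivergence, fDivergence_rpow hα, one_div, EReal.coe_inv,
    ← EReal.div_eq_inv_mul, EReal.div_le_iff_le_mul (by exact_mod_cast hβ) (EReal.coe_ne_top _),
    ← ENNReal.log_le_log_iff, EReal.log_exp]

theorem renyiDivergence_kleisliExt_le {α : ℝ} (hα : 1 < α) {X Y : MeasCat.{u}}
    (f g : X ⟶ subGiry.obj Y) {μ ν : SubProb X} {ρ ρ' : EReal}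
    (h : renyiDivergence α X μ ν ≤ ρ) (h' : ∀ x, renyiDivergence α Y (f.1 x) (g.1 x) ≤ ρ') :
    renyiDivergence α Y ((kleisliExt subGiry f).1 μ) ((kleisliExt subGiry g).1 ν) ≤ ρ + ρ' := by
  have hβ : 0 < α - 1 := sub_pos.2 hα
  refine (renyiDivergence_le_iff hα).2 ?_
  -- The identity `exp (x + y) = exp x * exp y` also holds at the infinities: `∞ + (-∞) = -∞`
  -- matches `∞ * 0 = 0`.
  rw [EReal.left_distrib_of_nonneg_of_ne_top (by exact_mod_cast hβ.le) (EReal.coe_ne_top _),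
    EReal.exp_add]
  refine (renyiIntegral_kleisliExt_le hβ f g μ ν
    fun x => (renyiDivergence_le_iff hα).1 (h' x)).trans ?_
  exact mul_le_mul_left ((renyiDivergence_le_iff hα).1 h) _

theorem renyiDivergence_self_le {α : ℝ} (hα : 1 < α) {X : MeasCat.{u}} (μ : SubProb X) :
    renyiDivergence α X μ μ ≤ 0 := by
  rw [renyiDivergence_le_iff hα, mul_zero, EReal.exp_zero]
  exact renyiIntegral_self_le (sub_pos.2 hα) μ

theorem isComposable_renyiDivergence {α : ℝ} (hα : 1 < α) :
    IsComposable.{u} (A := EReal) (fun _ => renyiDivergence α) (fun ρ => ρ) where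
  refl _ := renyiDivergence_self_le hα _
  mono hab _ _ _ h := h.trans hab
  comp f g _ _ h h' := renyiDivergence_kleisliExt_le hα f g h h'

/-! ### Zero-concentrated and truncated concentrated differential privacy -/

theorem one_div_mul_le_iff {α : ℝ} (hα : 0 < α) {x ρ : EReal} :
    ((1 / α : ℝ) : EReal) * x ≤ ρ ↔ x ≤ (α : EReal) * ρ := by
  rw [one_div, EReal.coe_inv, ← EReal.div_le_iff_le_mul (by exact_mod_cast hα)
    (EReal.coe_ne_top _), EReal.div_eq_inv_mul]

/-- The supremum unfolds into one condition per order, and `ξ` can be moved across because it is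
finite. The resulting bound is additive in `(ξ, ρ)` for each `α`. -/
theorem zcdpDivergence_le_iff {ξ : ℝ≥0} {ρ : EReal} {X : MeasCat.{u}} {μ ν : SubProb X} :
    zcdpDivergence ξ X μ ν ≤ ρ ↔
      ∀ α : ℝ, 1 < α → renyiDivergence α X μ ν ≤ (α : EReal) * ρ + ((ξ : ℝ) : EReal) := by
  rw [zcdpDivergence, iSup₂_le_iff]
  refine forall₂_congr fun α hα => ?_
  rw [one_div_mul_le_iff (by linarith), EReal.sub_le_iff_le_add (.inl (EReal.coe_ne_bot _))
    (.inl (EReal.coe_ne_top _))]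

theorem tcdpDivergence_le_iff {ω : ℝ} {ρ : EReal} {X : MeasCat.{u}} {μ ν : SubProb X} :
    tcdpDivergence ω X μ ν ≤ ρ ↔
      ∀ α : ℝ, 1 < α ∧ α < ω → renyiDivergence α X μ ν ≤ (α : EReal) * ρ := by
  rw [tcdpDivergence, iSup₂_le_iff]
  exact forall₂_congr fun α hα => one_div_mul_le_iff (by linarith)

theorem isComposable_zcdpDivergence : IsComposable.{u} (A := ℝ≥0 × EReal)
    (fun a => zcdpDivergence a.1) (fun a => a.2) where
  refl _ := zcdpDivergence_le_iff.2 fun α hα => by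
    simpa using renyiDivergence_self_le hα _
  mono {a b} hab X μ ν h := zcdpDivergence_le_iff.2 fun α hα => by
    refine (zcdpDivergence_le_iff.1 h α hα).trans ?_
    have h0 : (0 : EReal) ≤ α := by exact_mod_cast (by linarith : (0 : ℝ) ≤ α)
    exact add_le_add (mul_le_mul_of_nonneg_left hab.2 h0) (by exact_mod_cast hab.1)
  comp {a b X Y} f g μ ν h h' := zcdpDivergence_le_iff.2 fun α hα => by
    refine (renyiDivergence_kleisliExt_le hα f g (zcdpDivergence_le_iff.1 h α hα)
      fun x => zcdpDivergence_le_iff.1 (h' x) α hα).trans_eq ?_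
    rw [Prod.snd_add, Prod.fst_add, EReal.left_distrib_of_nonneg_of_ne_top
      (by exact_mod_cast (by linarith : (0 : ℝ) ≤ α)) (EReal.coe_ne_top _), NNReal.coe_add,
      EReal.coe_add, add_add_add_comm]

theorem isComposable_tcdpDivergence (ω : ℝ) :
    IsComposable.{u} (A := EReal) (fun _ => tcdpDivergence ω) (fun ρ => ρ) where
  refl _ := tcdpDivergence_le_iff.2 fun α hα => by
    simpa using renyiDivergence_self_le hα.1 _
  mono hab _ _ _ h := h.trans hab
  comp {a b X Y} f g μ ν h h' := tcdpDivergence_le_iff.2 fun α hα => by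
    refine (renyiDivergence_kleisliExt_le hα.1 f g (tcdpDivergence_le_iff.1 h α hα)
      fun x => tcdpDivergence_le_iff.1 (h' x) α hα).trans_eq ?_
    rw [EReal.left_distrib_of_nonneg_of_ne_top
      (by exact_mod_cast (by linarith [hα.1] : (0 : ℝ) ≤ α)) (EReal.coe_ne_top _)]

end SpanLifting

theorem mainTheorem3 :
    (SpanLifting.IsGradedLiftingWithDoubleStrength.{u} (A := ℝ≥0 × ℝ≥0)
      (fun a => SpanLifting.dpDivergence a.1) (fun a => ((a.2 : ℝ) : EReal))) ∧
    (∀ α : ℝ, 1 < α → SpanLifting.IsGradedLiftingWithDoubleStrength.{u} (A := EReal)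
      (fun _ => SpanLifting.renyiDivergence α) (fun ρ => ρ)) ∧
    (SpanLifting.IsGradedLiftingWithDoubleStrength.{u} (A := ℝ≥0 × EReal)
      (fun a => SpanLifting.zcdpDivergence a.1) (fun a => a.2)) ∧
    (∀ ω : ℝ, 1 < ω → SpanLifting.IsGradedLiftingWithDoubleStrength.{u} (A := EReal)
      (fun _ => SpanLifting.tcdpDivergence ω) (fun ρ => ρ)) :=
  ⟨SpanLifting.isComposable_dpDivergence.isGradedLiftingWithDoubleStrength,
    fun _ hα => (SpanLifting.isComposable_renyiDivergence hα).isGradedLiftingWithDoubleStrength,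
    SpanLifting.isComposable_zcdpDivergence.isGradedLiftingWithDoubleStrength,
    fun ω _ => (SpanLifting.isComposable_tcdpDivergence ω).isGradedLiftingWithDoubleStrength⟩
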